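/- Let $\kappa$ be a regular uncountable cardinal and let $T$ be a $\kappa$-Souslin tree, that is, a tree of height $\kappa$ all of whose levels have size less than $\kappa$, with no chains of size $\kappa$ and no antichains of size $\kappa$. A ladder system over a stationary set $S\subseteq\kappa$ is a sequence $L=\langle A_\delta\mid\delta\in S\rangle$ where each $A_\delta$ is a cofinal subset of $\delta$. Its space $X_L$ has underlying set $(\kappa\times\{0\})\cup(S\times\{1\})$; the points of $\kappa\times\{0\}$ are isolated, and the basic neighbourhoods of $(\delta,1)$ are the sets $(A\times\{0\})\cup\{(\delta,1)\}$ with $A$ an end segment of $A_\delta$. A space $X$ is countably metacompact if for every decreasing sequence $\langle D_n\mid n<\omega\rangle$ of closed subsets of $X$ with empty intersection there is a decreasing sequence $\langle U_n\mid n<\omega\rangle$ of open subsets of $X$ with empty intersection such that $D_n\subseteq U_n$ for all $n$. Then: (1) There are a stationary set $S\subseteq\kappa$ and a ladder system $L$ over $S$ such that $X_L$ is a regular Hausdorff space that is not countably metacompact. (2) Suppose that $T$ is regressive: there is a map $\rho:T\to T$ such that $\rho(x)<_T x$ for every node $x$ of limit height, and such that $\rho(x)<_T y$ and $\rho(y)<_T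 x$ imply $x=y$ for all nodes $x,y$ of the same limit height. Then there is a ladder system $L$ over $E^\kappa_\omega=\{\delta<\kappa\mid\mathrm{cf}(\delta)=\omega\}$ (in particular, this set is stationary) such that $X_L$ is a regular Hausdorff space that is not countably metacompact and is first countable. (3) If $T$ is coherent, then $T$ is regressive, so that (2) applies. Here $T$ is coherent if it is isomorphic to a tree of functions from ordinals to ordinals, closed under restriction to smaller ordinals and ordered by end-extension, in which any two functions with the same domain differ at only finitely many places. -/

import Mathlib

open Cardinal

universe u

/-! ### Set-theoretic trees -/

/-- A (set-theoretic) tree: a partially ordered set in which the set of strict predecessors of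
every node is well-ordered. -/
class IsSetTree (T : Type u) [PartialOrder T] : Prop where
  isWellOrder_Iio : ∀ x : T, IsWellOrder (Set.Iio x) (· < ·)

attribute [instance] IsSetTree.isWellOrder_Iio

namespace SetTree

variable {T : Type u} [PartialOrder T] [IsSetTree T]

/-- The height of a node: the order type of the set of its strict predecessors. -/
noncomputable def ht (x : T) : Ordinal.{u} :=
  Ordinal.type (fun a b : Set.Iio x => a < b)

/-- The `α`-th level of the tree. -/
def level (T : Type u) [PartialOrder T] [IsSetTree T] (α : Ordinal.{u}) : Set T :=
  {x | ht x = α}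

/-- `T` is a `κ`-tree: its height is `κ` (the levels of index below `κ` are exactly the nonempty
ones), and all of its levels have size less than `κ`. -/
structure IsKappaTree (κ : Cardinal.{u}) (T : Type u) [PartialOrder T] [IsSetTree T] : Prop where
  ht_lt : ∀ x : T, ht x < κ.ord
  level_nonempty : ∀ α < κ.ord, (level T α).Nonempty
  card_level_lt : ∀ α < κ.ord, #(level T α) < κ

/-- `T` is a `κ`-Souslin tree: a `κ`-tree with no chains of size `κ` (equivalently, no cofinal
branch) and no antichains of size `κ`. -/
structure IsSouslin (κ : Cardinal.{u}) (T : Type u) [PartialOrder T] [IsSetTree T] : Prop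
    extends IsKappaTree κ T where
  card_chain_lt : ∀ C : Set T, IsChain (· ≤ ·) C → #C < κ
  card_antichain_lt : ∀ A : Set T, IsAntichain (· ≤ ·) A → #A < κ

/-- `T` is regressive: there is a map `ρ` sending every node `x` of limit height strictly below
itself, such that two distinct nodes `x`, `y` of the same limit height never satisfy both
`ρ x < y` and `ρ y < x`. -/
def IsRegressive (T : Type u) [PartialOrder T] [IsSetTree T] : Prop :=
  ∃ ρ : T → T, (∀ x, Order.IsSuccLimit (ht x) → ρ x < x) ∧
    ∀ x y, Order.IsSuccLimit (ht x) → ht x = ht y → ρ x < y → ρ y < x → x = y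

/-- `T` is coherent: it is (isomorphic to) a tree of functions from ordinals, ordered by
end-extension, in which any two nodes of the same height differ at finitely many places only.
The node `x` is represented by the restriction of `e x` to `ht x`. -/
def IsCoherent (T : Type u) [PartialOrder T] [IsSetTree T] : Prop :=
  ∃ e : T → Ordinal.{u} → Ordinal.{u},
    (∀ x y, x ≤ y ↔ ht x ≤ ht y ∧ ∀ ξ < ht x, e x ξ = e y ξ) ∧
    ∀ x y, ht x = ht y → {ξ | ξ < ht x ∧ e x ξ ≠ e y ξ}.Finite

end SetTree

/-! ### Ladder systems and their spaces -/

/-- The set `κ`, as the set of all ordinals below (the initial ordinal of) `κ`. -/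
abbrev OrdBelow (κ : Cardinal.{u}) : Type (u + 1) := Set.Iio κ.ord

/-- `E^κ_ω`, the set of all `δ < κ` of countably infinite cofinality. -/
def cofOmega (κ : Cardinal.{u}) : Set (OrdBelow κ) :=
  {δ | Ordinal.cof (δ : Ordinal.{u}) = ℵ₀}

/-- A ladder system over a stationary subset `S` of `κ`: a choice, for every `δ ∈ S`, of a
cofinal subset of `δ`. -/
structure LadderSystem (κ : Cardinal.{u}) (S : Set (OrdBelow κ)) where
  isStationary : IsStationary S
  ladder : S → Set (OrdBelow κ)
  lt_of_mem : ∀ (δ : S), ∀ α ∈ ladder δ, α < (δ : OrdBelow κ)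
  cofinal : ∀ (δ : S), ∀ β < (δ : OrdBelow κ), ∃ α ∈ ladder δ, β ≤ α

/-- `A` is an end segment of `B`: an upward closed subset of `B`, nonempty if `B` is. -/
structure IsEndSegment {P : Type*} [LinearOrder P] (A B : Set P) : Prop where
  subset : A ⊆ B
  upward : ∀ α ∈ A, ∀ β ∈ B, α ≤ β → β ∈ A
  nonempty : B.Nonempty → A.Nonempty

theorem IsEndSegment.refl {P : Type*} [LinearOrder P] (B : Set P) : IsEndSegment B B :=
  ⟨subset_rfl, fun _ _ _ h _ => h, id⟩

theorem IsEndSegment.inter {P : Type*} [LinearOrder P] {A A' B : Set P}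
    (h : IsEndSegment A B) (h' : IsEndSegment A' B) : IsEndSegment (A ∩ A') B := by
  refine ⟨fun x hx => h.subset hx.1, fun α hα β hβ hαβ =>
    ⟨h.upward α hα.1 β hβ hαβ, h'.upward α hα.2 β hβ hαβ⟩, fun hB => ?_⟩
  obtain ⟨a, ha⟩ := h.nonempty hB
  obtain ⟨b, hb⟩ := h'.nonempty hB
  rcases le_total a b with hab | hab
  · exact ⟨b, h.upward a ha b (h'.subset hb) hab, hb⟩
  · exact ⟨a, ha, h'.upward b hb a (h.subset ha) hab⟩

namespace LadderSystem

variable {κ : Cardinal.{u}} {S : Set (OrdBelow κ)}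

/-- The underlying set `(κ × {0}) ∪ (S × {1})` of the space `X_L` of a ladder system. -/
inductive Space (L : LadderSystem κ S) : Type (u + 1)
  | zero (α : OrdBelow κ) : Space L
  | one (δ : S) : Space L

/-- The topology of `X_L`: all points `(α, 0)` are isolated, and the basic neighbourhoods of
`(δ, 1)` are the sets `(A × {0}) ∪ {(δ, 1)}` with `A` an end segment of the ladder at `δ`. -/
instance (L : LadderSystem κ S) : TopologicalSpace (Space L) where
  IsOpen U := ∀ δ : S, Space.one δ ∈ U →
    ∃ A, IsEndSegment A (L.ladder δ) ∧ ∀ α ∈ A, Space.zero α ∈ U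
  isOpen_univ := fun δ _ => ⟨L.ladder δ, IsEndSegment.refl _, fun _ _ => trivial⟩
  isOpen_inter := fun U V hU hV δ hδ => by
    obtain ⟨A, hA, hAU⟩ := hU δ hδ.1
    obtain ⟨B, hB, hBV⟩ := hV δ hδ.2
    exact ⟨A ∩ B, hA.inter hB, fun α hα => ⟨hAU α hα.1, hBV α hα.2⟩⟩
  isOpen_sUnion := fun 𝒰 h𝒰 δ hδ => by
    obtain ⟨U, hU, hδU⟩ := hδ
    obtain ⟨A, hA, hAU⟩ := h𝒰 U hU δ hδU
    exact ⟨A, hA, fun α hα => ⟨U, hU, hAU α hα⟩⟩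

end LadderSystem

/-- `X` is countably metacompact: for every decreasing sequence of closed sets with empty
intersection there is a decreasing sequence of open sets with empty intersection which contain
them termwise. -/
def CountablyMetacompact (X : Type*) [TopologicalSpace X] : Prop :=
  ∀ D : ℕ → Set X, Antitone D → (∀ n, IsClosed (D n)) → ⋂ n, D n = ∅ →
    ∃ U : ℕ → Set X, Antitone U ∧ (∀ n, IsOpen (U n)) ∧ ⋂ n, U n = ∅ ∧ ∀ n, D n ⊆ U n

/-! ### Club and stationary subsets of regular well-orders -/

section Stationary

open Order Set

variable {α : Type u} [LinearOrder α]

/-! Call a node pruned if it has extensions of arbitrarily large height. A vanishing branch `b δ` is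
a branch of length `δ` through pruned nodes that no pruned node of height `δ` bounds. Code nodes
injectively by ordinals via `ψ`, and take `ψ '' b δ` as the ladder at `δ`, for `δ` in a club where
codes and heights match. If `δ' < δ`, then `b δ` passes through a pruned node of height `δ'`, which
does not bound `b δ'`; so the branches split below `δ'` and the ladders meet boundedly
(`IsVanishingBranch.exists_bound`). Basic neighbourhoods are therefore clopen, which gives
regularity and the Hausdorff property.

Countable metacompactness fails once some `f : S → ℕ` has this property: every `g : κ → ℕ` satisfies
`g α ≤ f δ` cofinally along the ladder at some `δ` (`not_countablyMetacompact`). Such an `f` comes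
from `IsSouslin.exists_coloring`. A Solovay-style splitting gives unboundedly many disjoint
stationary fibers; each fiber `i` has a node `t i` such that every pruned node above it lies on
stationarily many branches from that fiber. By Souslinity a single node `t₀` is above infinitely
many `t i`; number these fibers by `ℕ`. Any `g` takes some value `n` densely above a node beyond
`t₀`, and pressing down on the `n`-th fiber finds a branch meeting that value cofinally.

Vanishing branches arise from maximal chains of pruned nodes, which are bounded in height
(`isStationary_vanishing`). In the regressive case they are built in `ω` steps, each step excluding
every node `x` of level `δ` whose `ρ x` has already been reached. -/

theorem exists_forall_lt_of_mk_lt_cof {A : Set α} (hA : #A < cof α) : ∃ x, ∀ a ∈ A, a < x := by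
  have : ¬ IsCofinal A := fun h => (cof_le h).not_gt hA
  simpa [IsCofinal] using this

theorem isClub_Ioi [NoMaxOrder α] (x : α) : IsClub (Ioi x) where
  dirSupClosed := by
    rintro d hd ⟨y, hy⟩ - a ha
    exact (hd hy).trans_le (ha.1 hy)
  isCofinal y := by
    obtain ⟨z, hz⟩ := exists_gt (max x y)
    exact ⟨z, (le_max_left _ _).trans_lt hz, (le_max_right _ _).trans hz.le⟩

variable [WellFoundedLT α]

theorem exists_isLUB_of_bddAbove {A : Set α} (hA : BddAbove A) : ∃ x, IsLUB A x :=
  ⟨wellFounded_lt.min _ hA, wellFounded_lt.min_mem _ hA,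
    fun _ hy => not_lt.1 (wellFounded_lt.not_lt_min _ hy)⟩

theorem exists_isLUB_range_nat (hα : ℵ₀ < cof α) (s : ℕ → α) : ∃ x, IsLUB (range s) x := by
  obtain ⟨x, hx⟩ := exists_forall_lt_of_mk_lt_cof
    (A := range s) (((le_aleph0_iff_set_countable).2 (countable_range s)).trans_lt hα)
  exact exists_isLUB_of_bddAbove ⟨x, fun a ha => (hx a ha).le⟩

/-- Diagonal intersections of club sets are club. -/
theorem isClub_diagonal [NoMaxOrder α] (hα : ℵ₀ < cof α) (hI : ∀ x : α, #(Iic x) < cof α)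
    {C : α → Set α} (hC : ∀ x, IsClub (C x)) : IsClub {δ | ∀ β < δ, δ ∈ C β} where
  dirSupClosed := by
    intro d hd _ _ a ha β hβ
    obtain ⟨δ, hδ, hβδ⟩ := (lt_isLUB_iff ha).1 hβ
    refine (hC β).isLUB_mem (t := d ∩ Ici δ) (fun x hx => hd hx.1 β (hβδ.trans_le hx.2))
      ⟨δ, hδ, le_rfl⟩ ⟨fun x hx => ha.1 hx.1, fun y hy => ha.2 fun x hx => ?_⟩
    rcases le_total δ x with h | h
    · exact hy ⟨hx, h⟩
    · exact h.trans (hy ⟨hδ, le_rfl⟩)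
  isCofinal := by
    intro x₀
    have step : ∀ x : α, ∃ y, x < y ∧ ∀ β ≤ x, ∃ c ∈ C β, x ≤ c ∧ c < y := by
      intro x
      choose c hc hxc using fun β => (hC β).isCofinal x
      obtain ⟨y, hy⟩ := exists_forall_lt_of_mk_lt_cof
        (A := range fun β : Iic x => c β) (mk_range_le.trans_lt (hI x))
      refine ⟨y, (hxc x).trans_lt (hy _ ⟨⟨x, le_rfl⟩, rfl⟩), fun β hβ =>
        ⟨c β, hc β, hxc β, hy _ ⟨⟨β, hβ⟩, rfl⟩⟩⟩
    choose H hH hHC using step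
    let s : ℕ → α := fun n => H^[n] x₀
    have hs : ∀ n, s (n + 1) = H (s n) := fun n => Function.iterate_succ_apply' H n x₀
    have hmono : StrictMono s := strictMono_nat_of_lt_succ fun n => by rw [hs]; exact hH _
    obtain ⟨a, ha⟩ := exists_isLUB_range_nat hα s
    refine ⟨a, fun β hβ => ?_, ha.1 ⟨0, rfl⟩⟩
    obtain ⟨_, ⟨n, rfl⟩, hβn⟩ := (lt_isLUB_iff ha).1 hβ
    -- Once `s n` exceeds `β`, elements of `C β` interleave with the sequence, so its supremum `a`
    -- is a limit of `C β`.
    have key : ∀ m, n ≤ m → ∃ c ∈ C β, s m ≤ c ∧ c < s (m + 1) := fun m hm => by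
      rw [hs]; exact hHC _ _ (hβn.le.trans (hmono.monotone hm))
    refine (hC β).isLUB_mem (t := C β ∩ Iio a) inter_subset_left ?_ ⟨fun x hx => hx.2.le, ?_⟩
    · obtain ⟨c, hc, -, hc'⟩ := key n le_rfl
      exact ⟨c, hc, hc'.trans_le (ha.1 ⟨n + 1, rfl⟩)⟩
    · refine fun y hy => ha.2 ?_
      rintro _ ⟨m, rfl⟩
      obtain ⟨c, hc, hmc, hc'⟩ := key (max n m) (le_max_left _ _)
      exact (hmono.monotone (le_max_right n m)).trans
        (hmc.trans (hy ⟨hc, hc'.trans_le (ha.1 ⟨_, rfl⟩)⟩))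

theorem isClub_closed_under [NoMaxOrder α] (hα : ℵ₀ < cof α) (hI : ∀ x : α, #(Iic x) < cof α)
    (F : α → α) : IsClub {δ | ∀ β < δ, F β < δ} :=
  isClub_diagonal hα hI fun x => isClub_Ioi (F x)

theorem IsStationary.inter_isClub (hα : ℵ₀ < cof α) {S C : Set α} (hS : IsStationary S)
    (hC : IsClub C) : IsStationary (S ∩ C) := fun D hD => by
  rw [inter_assoc]
  exact hS (hC.inter hα.ne' hD)

/-- Fodor's pressing down lemma. -/
theorem IsStationary.exists_isStationary_fiber [NoMaxOrder α] (hα : ℵ₀ < cof α)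
    (hI : ∀ x : α, #(Iic x) < cof α) {S : Set α} (hS : IsStationary S) {r : α → α}
    (hr : ∀ δ ∈ S, r δ < δ) : ∃ β, IsStationary {δ ∈ S | r δ = β} := by
  by_contra! h
  simp_rw [not_isStationary_iff] at h
  choose C hC hd using h
  obtain ⟨δ, hδ, hδC⟩ := hS (isClub_diagonal hα hI hC)
  exact (hd (r δ)).le_bot ⟨⟨hδ, rfl⟩, hδC _ (hr δ hδ)⟩

theorem isClub_limitPoints [NoMaxOrder α] (hα : ℵ₀ < cof α) (hI : ∀ x : α, #(Iic x) < cof α)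
    {C : Set α} (hC : IsCofinal C) : IsClub {δ | ∀ β < δ, ∃ γ ∈ C, β < γ ∧ γ < δ} := by
  choose F hF using fun x : α => exists_gt x
  choose G hG hFG using fun x => hC (F x)
  convert! isClub_closed_under hα hI fun x =>
    wellFounded_lt.min {y | y ∈ C ∧ x < y} ⟨G x, hG x, (hF x).trans_le (hFG x)⟩ using 1
  ext δ
  refine forall₂_congr fun β hβ => ⟨?_, fun h => ?_⟩
  · rintro ⟨γ, hγ, h1, h2⟩
    exact (not_lt.1 (wellFounded_lt.not_lt_min _ (show γ ∈ {y | y ∈ C ∧ β < y} from ⟨hγ, h1⟩))).trans_lt h2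
  · have := wellFounded_lt.min_mem {y | y ∈ C ∧ β < y} ⟨G β, hG β, (hF β).trans_le (hFG β)⟩
    exact ⟨_, this.1, this.2, h⟩

/-- The points of a stationary set `S` at which `S` does not reflect, as witnessed by a cofinal
subset without limit points in `S`, form a stationary set. -/
theorem IsStationary.exists_nonreflecting [NoMaxOrder α] (hα : ℵ₀ < cof α)
    (hI : ∀ x : α, #(Iic x) < cof α) {S : Set α} (hS : IsStationary S)
    (hbot : ∀ δ ∈ S, ∃ β, β < δ) :
    IsStationary {δ ∈ S | ∃ E : Set α, (∀ β < δ, ∃ ε ∈ E, β < ε ∧ ε < δ) ∧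
      ∀ γ ∈ S, γ < δ → ∃ β < γ, ∀ ε ∈ E, ε < γ → ε ≤ β} := by
  intro C hC
  have hL := isClub_limitPoints hα hI hC.isCofinal
  have hne := hS hL
  -- By minimality, no smaller point of `S` is a limit point of `C`; hence `C` itself serves as `E`.
  set δ := wellFounded_lt.min _ hne with hδdef
  obtain ⟨hδS, hδL⟩ := wellFounded_lt.min_mem _ hne
  refine ⟨δ, ⟨hδS, C, hδL, fun γ hγ hγδ => ?_⟩, ?_⟩
  · by_contra! h
    exact wellFounded_lt.not_lt_min _ (show γ ∈ S ∩ _ from ⟨hγ, fun β hβ => by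
      obtain ⟨ε, h1, h2, h3⟩ := h β hβ
      exact ⟨ε, h1, h3, h2⟩⟩) hγδ
  · obtain ⟨β, hβ⟩ := hbot δ hδS
    obtain ⟨ε, hε, -, hεδ⟩ := hδL β hβ
    refine hC.isLUB_mem (t := C ∩ Iio δ) inter_subset_left ⟨ε, hε, hεδ⟩
      ⟨fun x hx => hx.2.le, fun y hy => ?_⟩
    by_contra! hlt
    obtain ⟨ε', h1, h2, h3⟩ := hδL y hlt
    exact (hy ⟨h1, h3⟩).not_gt h2

/-- Solovay's argument: a nonreflecting stationary set carries a function which is constant on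
stationary sets for unboundedly many values. -/
theorem IsStationary.exists_fibers [NoMaxOrder α] (hα : ℵ₀ < cof α)
    (hI : ∀ x : α, #(Iic x) < cof α) {X : Set α} (hX : IsStationary X)
    {E : α → Set α} (hE : ∀ δ ∈ X, ∀ β < δ, ∃ ε ∈ E δ, β < ε ∧ ε < δ)
    (hE' : ∀ δ ∈ X, ∀ γ ∈ X, γ < δ → ∃ β < γ, ∀ ε ∈ E δ, ε < γ → ε ≤ β) :
    ∃ r : α → α, ∀ η, ∃ i ≥ η, IsStationary {δ ∈ X | r δ = i} := by
  classical
  have hmin : ∀ β δ, ∃ ε, δ ∈ X → β < δ → (ε ∈ E δ ∧ β < ε ∧ ε < δ) ∧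
      ∀ ε' ∈ E δ, β < ε' → ε ≤ ε' := by
    intro β δ
    by_cases h : δ ∈ X ∧ β < δ
    · have hne : {ε | ε ∈ E δ ∧ β < ε ∧ ε < δ}.Nonempty := hE δ h.1 β h.2
      refine ⟨wellFounded_lt.min _ hne, fun _ _ => ⟨wellFounded_lt.min_mem _ hne, ?_⟩⟩
      intro ε' h1 h2
      by_contra! hlt
      exact wellFounded_lt.not_lt_min _ (show ε' ∈ {ε | ε ∈ E δ ∧ β < ε ∧ ε < δ} from
        ⟨h1, h2, hlt.trans (wellFounded_lt.min_mem _ hne).2.2⟩) hlt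
    · exact ⟨β, fun h1 h2 => (h ⟨h1, h2⟩).elim⟩
  choose r hr hrmin using hmin
  -- `r β δ` is the least element of `E δ` above `β`. If for each `β` it were bounded by `η β` on a
  -- club, take `γ < δ` in `X`, both in the diagonal club closed under `η`. With `β < γ` bounding `E
  -- δ` below `γ`, the element `r β δ` would lie in `E δ` strictly between `β` and `γ`.
  have hstat : ∃ β, ∀ η, IsStationary {δ ∈ X | β < δ ∧ η ≤ r β δ} := by
    by_contra! h
    choose η hη using h
    simp_rw [not_isStationary_iff] at hη
    choose C hC hd using hη
    have hD : IsClub ({δ | ∀ β < δ, δ ∈ C β} ∩ {δ | ∀ β < δ, η β < δ}) :=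
      (isClub_diagonal hα hI hC).inter hα.ne' (isClub_closed_under hα hI η)
    obtain ⟨γ, hγX, hγC, hγη⟩ := hX hD
    obtain ⟨δ, ⟨hδX, hδC, hδη⟩, hγδ⟩ := hX.inter_isClub hα hD (isClub_Ioi γ)
    obtain ⟨β, hβ, hβE⟩ := hE' δ hδX γ hγX hγδ
    have hβδ := hβ.trans hγδ
    have h1 : r β δ < η β := by
      by_contra! h
      exact (hd β).le_bot ⟨⟨hδX, hβδ, h⟩, hδC β hβδ⟩
    have h2 := hr β δ hδX hβδ
    exact (hβE _ h2.1 (h1.trans (hγη β hβ))).not_gt h2.2.1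
  obtain ⟨β, hβ⟩ := hstat
  refine ⟨r β, fun η => ?_⟩
  obtain ⟨i, hi⟩ := (hβ η).exists_isStationary_fiber hα hI (r := r β)
    fun δ hδ => (hr β δ hδ.1 hδ.2.1).2.2
  obtain ⟨δ, ⟨hδ, hδi⟩⟩ := hi.nonempty
  exact ⟨i, hδi ▸ hδ.2.2, hi.mono fun x hx => ⟨hx.1.1, hx.2⟩⟩

end Stationary

/-! ### The order of ordinals below a regular uncountable cardinal -/

namespace OrdBelow

open Order Set

variable {κ : Cardinal.{u}}

theorem cof_eq (hκ : κ.IsRegular) : Order.cof (OrdBelow κ) = Cardinal.lift.{u + 1} κ := by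
  rw [Ordinal.cof_Iio, ← Ordinal.lift_cof, hκ.cof_ord]

theorem aleph0_lt_cof (hκ : κ.IsRegular) (h : ℵ₀ < κ) : ℵ₀ < Order.cof (OrdBelow κ) := by
  rw [cof_eq hκ]; simpa using h

theorem mk_Iic_lt (hκ : κ.IsRegular) (x : OrdBelow κ) : #(Iic x) < Order.cof (OrdBelow κ) := by
  rw [cof_eq hκ]
  have hx : succ (x : Ordinal.{u}) < κ.ord :=
    (isSuccLimit_ord hκ.aleph0_le).succ_lt x.2
  calc #(Iic x) ≤ #(Iio (succ (x : Ordinal.{u}))) :=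
        mk_le_of_injective (f := fun y : Iic x => (⟨y.1.1, lt_succ_of_le y.2⟩ : Iio _))
          fun a b h => by simpa [Subtype.ext_iff] using h
    _ = Cardinal.lift.{u + 1} (succ (x : Ordinal.{u})).card := Cardinal.mk_Iio_ordinal _
    _ < _ := by rw [Cardinal.lift_lt]; exact Cardinal.lt_ord.1 hx

theorem noMaxOrder (hκ : κ.IsRegular) : NoMaxOrder (OrdBelow κ) where
  exists_gt x := ⟨⟨succ (x : Ordinal.{u}), (isSuccLimit_ord hκ.aleph0_le).succ_lt x.2⟩,
    lt_succ (x : Ordinal.{u})⟩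

theorem exists_forall_lt (hκ : κ.IsRegular) {ι : Type u} (hι : #ι < κ) (f : ι → OrdBelow κ) :
    ∃ β, ∀ i, f i < β := by
  obtain ⟨β, hβ⟩ := exists_forall_lt_of_mk_lt_cof (A := range f) (by
    rw [cof_eq hκ]
    have := mk_range_le_lift (f := f)
    rw [Cardinal.lift_id'.{u, u + 1}] at this
    exact this.trans_lt (Cardinal.lift_lt.2 hι))
  exact ⟨β, fun i => hβ _ ⟨i, rfl⟩⟩

end OrdBelow

/-! ### Heights, tall sets and the pruned part of a tree. -/

namespace SetTree

open Order Set

section Height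

variable {T : Type u} [PartialOrder T] [IsSetTree T]

theorem typein_Iio_eq_ht {x y : T} (h : x < y) :
    Ordinal.typein (fun a b : Iio y => a < b) ⟨x, h⟩ = ht x := by
  rw [ht, ← Ordinal.type_subrel, Ordinal.type_eq]
  exact ⟨{ toFun := fun b => ⟨b.1.1, b.2⟩
           invFun := fun b => ⟨⟨b.1, b.2.trans h⟩, b.2⟩
           left_inv := fun _ => rfl
           right_inv := fun _ => rfl
           map_rel_iff' := Iff.rfl }⟩

theorem ht_lt_ht {x y : T} (h : x < y) : ht x < ht y :=
  typein_Iio_eq_ht h ▸ Ordinal.typein_lt_type _ _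

theorem ht_le_ht {x y : T} (h : x ≤ y) : ht x ≤ ht y := by
  rcases h.eq_or_lt with rfl | h
  exacts [le_rfl, (ht_lt_ht h).le]

theorem exists_lt_ht_eq {x : T} {β : Ordinal.{u}} (h : β < ht x) : ∃ y < x, ht y = β := by
  obtain ⟨⟨y, hy⟩, rfl⟩ := Ordinal.typein_surj (fun a b : Iio x => a < b) h
  exact ⟨y, hy, (typein_Iio_eq_ht hy).symm⟩

theorem le_or_le {x y z : T} (hx : x ≤ z) (hy : y ≤ z) : x ≤ y ∨ y ≤ x := by
  rcases hx.eq_or_lt with rfl | hx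
  · exact .inr hy
  rcases hy.eq_or_lt with rfl | hy
  · exact .inl hx.le
  rcases trichotomous_of (fun a b : Iio z => a < b) ⟨x, hx⟩ ⟨y, hy⟩ with h | h | h
  · exact .inl (le_of_lt h)
  · exact .inl (congrArg Subtype.val h).le
  · exact .inr (le_of_lt h)

theorem le_of_ht_le {x y z : T} (hx : x ≤ z) (hy : y ≤ z) (h : ht x ≤ ht y) : x ≤ y := by
  rcases le_or_le hx hy with h' | h'
  · exact h'
  · rcases h'.eq_or_lt with rfl | h'
    · exact le_rfl
    · exact ((ht_lt_ht h').not_ge h).elim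

end Height

variable {κ : Cardinal.{u}} {T : Type u} [PartialOrder T] [IsSetTree T]

/-- The height of a node of a `κ`-tree, as an ordinal below `κ`. -/
noncomputable def IsKappaTree.height (hT : IsKappaTree κ T) (x : T) : OrdBelow κ :=
  ⟨ht x, hT.ht_lt x⟩

namespace IsKappaTree

variable (hT : IsKappaTree κ T)

theorem height_lt {x y : T} (h : x < y) : hT.height x < hT.height y := ht_lt_ht h

theorem height_mono {x y : T} (h : x ≤ y) : hT.height x ≤ hT.height y := ht_le_ht h

theorem exists_le_height_eq {x : T} {β : OrdBelow κ} (h : β ≤ hT.height x) :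
    ∃ y ≤ x, hT.height y = β := by
  rcases h.eq_or_lt with rfl | h
  · exact ⟨x, le_rfl, rfl⟩
  · obtain ⟨y, hy, hyβ⟩ := exists_lt_ht_eq (show β.1 < ht x from h)
    exact ⟨y, hy.le, Subtype.ext hyβ⟩

theorem le_of_height_le {x y z : T} (hx : x ≤ z) (hy : y ≤ z) (h : hT.height x ≤ hT.height y) :
    x ≤ y := le_of_ht_le hx hy h

theorem mk_height_eq_lt (β : OrdBelow κ) : #{x // hT.height x = β} < κ := by
  refine lt_of_eq_of_lt ?_ (hT.card_level_lt β.1 β.2)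
  exact mk_congr (Equiv.subtypeEquivRight fun x => Subtype.ext_iff)

/-- A set of nodes is tall if it contains nodes of arbitrarily large height. -/
def IsTall (B : Set T) : Prop := ∀ β, ∃ x ∈ B, β ≤ hT.height x

/-- The pruned part of a tree: the nodes which have extensions of arbitrarily large height. -/
def pruned : Set T := {y | hT.IsTall (Ici y)}

theorem isTall_univ : hT.IsTall univ := fun β => by
  obtain ⟨x, hx⟩ := hT.level_nonempty β.1 β.2
  exact ⟨x, trivial, ge_of_eq (Subtype.ext hx)⟩

variable {hT}

theorem IsTall.mono {A B : Set T} (hA : hT.IsTall A) (h : A ⊆ B) : hT.IsTall B := fun β => by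
  obtain ⟨x, hx, hβ⟩ := hA β
  exact ⟨x, h hx, hβ⟩

theorem mem_pruned_of_le {x y : T} (hy : y ∈ hT.pruned) (h : x ≤ y) : x ∈ hT.pruned :=
  IsTall.mono hy (Ici_subset_Ici.2 h)

/-- Bounds on the heights in fewer than `κ` pieces have a common bound, by regularity. -/
theorem IsTall.exists_of_iUnion (hκ : κ.IsRegular) {ι : Type u} (hι : #ι < κ) {B : ι → Set T}
    (hB : hT.IsTall (⋃ i, B i)) : ∃ i, hT.IsTall (B i) := by
  by_contra! h
  simp only [IsTall, not_forall, not_exists, not_and, not_le] at h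
  choose β hβ using h
  obtain ⟨γ, hγ⟩ := OrdBelow.exists_forall_lt hκ hι β
  obtain ⟨x, hx, hγx⟩ := hB γ
  obtain ⟨i, hi⟩ := mem_iUnion.1 hx
  exact (hβ i x hi).not_ge ((hγ i).le.trans hγx)

/-- The cones over the fewer than `κ` nodes of one level cover everything at or above that level, so
one of them retains a tall part of `B`. -/
theorem IsTall.exists_height_eq (hκ : κ.IsRegular) {B : Set T} (hB : hT.IsTall B)
    (β : OrdBelow κ) : ∃ z, hT.height z = β ∧ hT.IsTall (B ∩ Ici z) := by
  obtain ⟨z, hz⟩ := IsTall.exists_of_iUnion (hT := hT) hκ (hT.mk_height_eq_lt β)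
    (B := fun z => B ∩ Ici z.1) (fun γ => by
      obtain ⟨x, hx, hγ⟩ := hB (max β γ)
      obtain ⟨y, hy, hyβ⟩ := hT.exists_le_height_eq ((le_max_left _ _).trans hγ)
      exact ⟨x, mem_iUnion.2 ⟨⟨y, hyβ⟩, hx, hy⟩, (le_max_right _ _).trans hγ⟩)
  exact ⟨z, z.2, hz⟩

theorem exists_mem_pruned (hT : IsKappaTree κ T) (hκ : κ.IsRegular) (β : OrdBelow κ) :
    ∃ z ∈ hT.pruned, hT.height z = β := by
  obtain ⟨z, hz, hz'⟩ := hT.isTall_univ.exists_height_eq hκ β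
  exact ⟨z, hz'.mono inter_subset_right, hz⟩

theorem exists_mem_pruned_ge (hκ : κ.IsRegular) {y : T} (hy : y ∈ hT.pruned) {β : OrdBelow κ}
    (hβ : hT.height y ≤ β) : ∃ z ∈ hT.pruned, y ≤ z ∧ hT.height z = β := by
  obtain ⟨z, hz, hz'⟩ := IsTall.exists_height_eq hκ hy β
  obtain ⟨w, ⟨hyw, hzw⟩, -⟩ := hz' β
  exact ⟨z, hz'.mono inter_subset_right, hT.le_of_height_le hyw hzw (hz ▸ hβ), hz⟩

theorem exists_mem_pruned_ge' (hκ : κ.IsRegular) {y : T} (hy : y ∈ hT.pruned) (β : OrdBelow κ) :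
    ∃ z ∈ hT.pruned, y ≤ z ∧ β ≤ hT.height z := by
  obtain ⟨z, h1, h2, h3⟩ := exists_mem_pruned_ge hκ hy (le_max_right β _)
  exact ⟨z, h1, h2, h3 ▸ le_max_left _ _⟩

theorem not_isTall (hκ : κ.IsRegular) {A : Set T} (hA : #A < κ) : ¬ hT.IsTall A := fun h => by
  obtain ⟨β, hβ⟩ := OrdBelow.exists_forall_lt hκ hA fun x => hT.height x
  obtain ⟨x, hx, hβx⟩ := h β
  exact (hβ ⟨x, hx⟩).not_ge hβx

theorem mk_height_le_lt (hT : IsKappaTree κ T) (hκ : κ.IsRegular) (β : OrdBelow κ) :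
    #{x | hT.height x ≤ β} < κ := by
  have hβ : (Order.succ β.1) < κ.ord := (isSuccLimit_ord hκ.aleph0_le).succ_lt β.2
  have : {x | hT.height x ≤ β} =
      ⋃ i : (Order.succ β.1).ToType, level T ((Ordinal.ToType.mk.symm i : Iio _) : Ordinal.{u}) := by
    ext x
    simp only [mem_ofPred_eq, mem_iUnion]
    constructor
    · intro h
      refine ⟨Ordinal.ToType.mk ⟨ht x, Order.lt_succ_of_le (show ht x ≤ β.1 from h)⟩, ?_⟩
      simp [level]
    · rintro ⟨i, hi⟩
      have hi' : ht x = _ := hi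
      have hlt : ht x < Order.succ β.1 := hi' ▸ (Ordinal.ToType.mk.symm i).2
      exact show ht x ≤ β.1 from Order.le_of_lt_succ hlt
  rw [this, Cardinal.card_iUnion_lt_iff_forall_of_isRegular hκ]
  · intro i
    exact hT.card_level_lt _ (lt_trans (Ordinal.ToType.mk.symm i).2 hβ)
  · rw [Cardinal.mk_toType]; exact Cardinal.lt_ord.1 hβ

end IsKappaTree

/-! ### Density arguments in Souslin trees. -/

namespace IsSouslin

variable (hT : IsSouslin κ T)

theorem not_isTall_chain (hκ : κ.IsRegular) {C : Set T} (hC : IsChain (· ≤ ·) C) :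
    ¬ hT.toIsKappaTree.IsTall C :=
  IsKappaTree.not_isTall hκ (hT.card_chain_lt C hC)

/-- In a Souslin tree, every tall set of nodes is dense above some node of the pruned part. -/
theorem exists_dense_above (hκ : κ.IsRegular) {B : Set T} (hB : hT.toIsKappaTree.IsTall B) :
    ∃ t ∈ hT.pruned, ∀ z ∈ hT.pruned, t ≤ z → ∃ w ∈ B, z ≤ w := by
  by_contra! h
  -- `Z` consists of the pruned nodes with nothing of `B` above them; if the claim fails, it is
  -- dense in the pruned part. A maximal antichain in `Z` has heights below some `β`. Over a node
  -- `z` of height `β` with tall `B` above it, some `z'` in `Z` must be comparable to a member of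
  -- the antichain. That member then lies below `z`, hence below an element of `B`.
  let Z : Set T := {z | z ∈ hT.pruned ∧ ∀ w ∈ B, ¬ z ≤ w}
  obtain ⟨A, hA⟩ := zorn_subset {A : Set T | A ⊆ Z ∧ IsAntichain (· ≤ ·) A} (by
    intro c hc hchain
    refine ⟨⋃₀ c, ⟨sUnion_subset fun s hs => (hc hs).1, ?_⟩, fun s hs => subset_sUnion_of_mem hs⟩
    rintro x ⟨s, hs, hx⟩ y ⟨s', hs', hy⟩ hxy
    rcases hchain.total hs hs' with hss | hss
    · exact (hc hs').2 (hss hx) hy hxy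
    · exact (hc hs).2 hx (hss hy) hxy)
  obtain ⟨β, hβ⟩ := OrdBelow.exists_forall_lt hκ (hT.card_antichain_lt A hA.prop.2)
    fun x => hT.height x
  obtain ⟨z, hzβ, hz⟩ := hB.exists_height_eq hκ β
  obtain ⟨z', hz'P, hzz', hz'B⟩ := h z (hz.mono inter_subset_right)
  have hcomp : ∃ a ∈ A, a ≤ z' ∨ z' ≤ a := by
    by_contra! hno
    have hz'A : z' ∉ A := fun h => (hno z' h).1 le_rfl
    refine hz'A (hA.le_of_ge (y := insert z' A) ⟨insert_subset ⟨hz'P, hz'B⟩ hA.prop.1, ?_⟩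
      (subset_insert _ _) (mem_insert _ _))
    exact hA.prop.2.insert (fun a ha _ => (hno a ha).1) fun a ha _ => (hno a ha).2
  obtain ⟨a, haA, ha⟩ := hcomp
  have hlt : hT.height a < hT.height z := hzβ ▸ hβ ⟨a, haA⟩
  have haz' : a ≤ z' := ha.resolve_right fun h =>
    (hlt.trans_le ((hT.height_mono hzz').trans (hT.height_mono h))).false
  have haz : a ≤ z := hT.le_of_height_le haz' hzz' hlt.le
  obtain ⟨w, ⟨hwB, hzw⟩, -⟩ := hz β
  exact (hA.prop.1 haA).2 w hwB (haz.trans hzw)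

/-- Otherwise the pruned nodes above `z` would form a tall chain. -/
theorem exists_incomparable (hκ : κ.IsRegular) {z : T} (hz : z ∈ hT.pruned) :
    ∃ u ∈ hT.pruned, ∃ v ∈ hT.pruned, z ≤ u ∧ z ≤ v ∧ ¬ u ≤ v ∧ ¬ v ≤ u := by
  by_contra! h
  refine hT.not_isTall_chain hκ (C := {u | u ∈ hT.pruned ∧ z ≤ u}) ?_ fun β => ?_
  · intro u hu v hv _
    by_cases huv : u ≤ v
    · exact .inl huv
    · exact .inr (h u hu.1 v hv.1 hu.2 hv.2 huv)
  · obtain ⟨y, h1, h2, h3⟩ := IsKappaTree.exists_mem_pruned_ge' hκ hz β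
    exact ⟨y, ⟨h1, h2⟩, h3⟩

end IsSouslin

end SetTree

/-! ### Vanishing branches and the colouring of levels. -/

namespace SetTree

open Order Set

variable {κ : Cardinal.{u}} {T : Type u} [PartialOrder T] [IsSetTree T]

/-- A vanishing `δ`-branch: a branch of height `δ` through the pruned part of the tree which has no
upper bound in the `δ`-th level of the pruned part. -/
structure IsVanishingBranch (hT : IsKappaTree κ T) (δ : OrdBelow κ) (b : Set T) : Prop where
  subset : b ⊆ hT.pruned
  chain : ∀ x ∈ b, ∀ y ∈ b, x ≤ y ∨ y ≤ x
  lower : ∀ x ∈ b, ∀ y ≤ x, y ∈ b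
  height_lt : ∀ x ∈ b, hT.height x < δ
  exists_height_eq : ∀ β < δ, ∃ x ∈ b, hT.height x = β
  not_bounded : ∀ x ∈ hT.pruned, hT.height x = δ → ∃ y ∈ b, ¬ y ≤ x

theorem IsVanishingBranch.le_of_height_le {hT : IsKappaTree κ T} {δ : OrdBelow κ} {b : Set T}
    (hb : IsVanishingBranch hT δ b) {x y : T} (hx : x ∈ b) (hy : y ∈ b)
    (h : hT.height x ≤ hT.height y) : x ≤ y := by
  rcases hb.chain x hx y hy with h' | h'
  · exact h'
  · exact hT.le_of_height_le le_rfl h' h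

namespace IsSouslin

variable (hT : IsSouslin κ T)

/-- Every stationary set of branches contains, for all nodes above some node, stationarily many
branches through that node. -/
theorem exists_isStationary_above (hκ : κ.IsRegular) (hκ' : ℵ₀ < κ) {X : Set (OrdBelow κ)}
    (hX : IsStationary X) {b : OrdBelow κ → Set T}
    (hb : ∀ δ ∈ X, IsVanishingBranch hT.toIsKappaTree δ (b δ)) :
    ∃ t ∈ hT.pruned, ∀ y ∈ hT.pruned, t ≤ y → IsStationary {δ ∈ X | y ∈ b δ} := by
  have := OrdBelow.noMaxOrder hκ
  have hα := OrdBelow.aleph0_lt_cof hκ hκ'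
  obtain ⟨t, ht, htG⟩ := hT.exists_dense_above hκ (B := {y | IsStationary {δ ∈ X | y ∈ b δ}}) (by
    intro β
    -- The branches of length above `β` are sorted by their node at height `β`; there are fewer than
    -- `κ` classes, so one is stationary.
    have h1 : IsStationary (⋃ x : {x // hT.height x = β}, {δ ∈ X | x.1 ∈ b δ}) := by
      refine (hX.inter_isClub hα (isClub_Ioi β)).mono ?_
      rintro δ ⟨hδ, hβδ⟩
      obtain ⟨x, hx, hxβ⟩ := (hb δ hδ).exists_height_eq β hβδ
      exact mem_iUnion.2 ⟨⟨x, hxβ⟩, hδ, hx⟩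
    obtain ⟨x, hx⟩ := (isStationary_iUnion_iff hα.ne' (by
      rw [OrdBelow.cof_eq hκ, Cardinal.lift_id'.{u, u + 1}, Cardinal.lift_lt]
      exact hT.mk_height_eq_lt β)).1 h1
    exact ⟨x, hx, x.2.ge⟩)
  refine ⟨t, ht, fun y hy hty => ?_⟩
  obtain ⟨w, hw, hyw⟩ := htG y hy hty
  exact IsStationary.mono hw fun δ hδ => ⟨hδ.1, (hb δ hδ.1).lower w hδ.2 y hyw⟩

/-- In a Souslin tree, some node of the pruned part is above infinitely many elements of a given
tall set. -/
theorem exists_infinite_le (hκ : κ.IsRegular) (hκ' : ℵ₀ < κ) {B : Set T}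
    (hB : hT.toIsKappaTree.IsTall B) (hBP : B ⊆ hT.pruned) :
    ∃ t ∈ hT.pruned, {w ∈ B | w ≤ t}.Infinite := by
  have := OrdBelow.noMaxOrder hκ
  by_contra! hfin
  obtain ⟨t₀, ht₀, htB⟩ := hT.exists_dense_above hκ hB
  -- `N` counts the elements of `B` below a node and is monotone. Some value `n` is dense above `t`,
  -- so `N` is bounded by `n` there. But `B` is dense too, so a node maximizing `N` has a higher
  -- element of `B` above it, which raises the count.
  let N : T → ℕ := fun z => {w ∈ B | w ≤ z}.ncard
  have hN : ∀ z ∈ hT.pruned, ∀ y ≤ z, N y ≤ N z := fun z hz y hy =>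
    ncard_le_ncard (fun w hw => ⟨hw.1, hw.2.trans hy⟩) (hfin z hz)
  obtain ⟨n, hn⟩ := IsKappaTree.IsTall.exists_of_iUnion (hT := hT.toIsKappaTree) hκ
    (ι := ULift.{u} ℕ) (by simpa using hκ')
    (B := fun n => {z | z ∈ hT.pruned ∧ t₀ ≤ z ∧ N z = n.down}) (fun β => by
      obtain ⟨z, h1, h2, h3⟩ := IsKappaTree.exists_mem_pruned_ge' hκ ht₀ β
      exact ⟨z, mem_iUnion.2 ⟨⟨N z⟩, h1, h2, rfl⟩, h3⟩)
  obtain ⟨t, ht, htN⟩ := hT.exists_dense_above hκ hn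
  -- Reaching the height of `t₀` forces `t₁` above `t₀`, since both lie below a common node.
  obtain ⟨t₁, ht₁, htt₁, ht₁h⟩ := IsKappaTree.exists_mem_pruned_ge' hκ ht (hT.height t₀)
  have ht₀₁ : t₀ ≤ t₁ := by
    obtain ⟨w, hw, hw'⟩ := htN t₁ ht₁ htt₁
    exact hT.le_of_height_le hw.2.1 hw' ht₁h
  have hbdd : BddAbove (N '' {z | z ∈ hT.pruned ∧ t₁ ≤ z}) := by
    refine ⟨n.down, ?_⟩
    rintro _ ⟨z, ⟨hz, htz⟩, rfl⟩
    obtain ⟨w, hw, hzw⟩ := htN z hz (htt₁.trans htz)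
    exact hw.2.2 ▸ hN w hw.1 z hzw
  obtain ⟨z, ⟨hz, htz⟩, hzmax⟩ := Nat.sSup_mem ⟨_, mem_image_of_mem N
    (show t₁ ∈ {z | z ∈ hT.pruned ∧ t₁ ≤ z} from ⟨ht₁, le_rfl⟩)⟩ hbdd
  obtain ⟨γ, hγ⟩ := exists_gt (hT.height z)
  obtain ⟨z', hz', hzz', hγz'⟩ := IsKappaTree.exists_mem_pruned_ge' hκ hz γ
  obtain ⟨w, hwB, hz'w⟩ := htB z' hz' (ht₀₁.trans (htz.trans hzz'))
  have hwP := hBP hwB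
  have hle : N w ≤ N z := hzmax ▸ le_csSup hbdd ⟨w, ⟨hwP, htz.trans (hzz'.trans hz'w)⟩, rfl⟩
  refine hle.not_gt (ncard_lt_ncard ⟨fun x hx => ⟨hx.1, hx.2.trans (hzz'.trans hz'w)⟩, fun h => ?_⟩
    (hfin w hwP))
  have hwz : w ≤ z := (h ⟨hwB, le_rfl⟩).2
  exact (hγ.trans_le (hγz'.trans (hT.height_mono (hz'w.trans hwz)))).false

/-- Given vanishing branches at stationarily many levels of a Souslin tree, there is a colouring of
these levels by natural numbers such that every colouring of the nodes is dominated by it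
cofinally often along one of the branches. -/
theorem exists_coloring (hκ : κ.IsRegular) (hκ' : ℵ₀ < κ) {S : Set (OrdBelow κ)}
    (hS : IsStationary S) (hbot : ∀ δ ∈ S, ∃ β, β < δ) {b : OrdBelow κ → Set T}
    (hb : ∀ δ ∈ S, IsVanishingBranch hT.toIsKappaTree δ (b δ)) :
    ∃ f : OrdBelow κ → ℕ, ∀ g : T → ℕ, ∃ δ ∈ S, ∀ β < δ, ∃ y ∈ b δ,
      β ≤ hT.height y ∧ g y ≤ f δ := by
  classical
  have := OrdBelow.noMaxOrder hκ
  have hα := OrdBelow.aleph0_lt_cof hκ hκ'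
  have hI := OrdBelow.mk_Iic_lt hκ
  obtain ⟨W, hWS, hW, hWE⟩ : ∃ W ⊆ S, IsStationary W ∧ ∀ δ ∈ W, ∃ E : Set (OrdBelow κ),
      (∀ β < δ, ∃ ε ∈ E, β < ε ∧ ε < δ) ∧
      ∀ γ ∈ S, γ < δ → ∃ β < γ, ∀ ε ∈ E, ε < γ → ε ≤ β :=
    ⟨_, fun _ h => h.1, hS.exists_nonreflecting hα hI hbot, fun _ h => h.2⟩
  choose! E hE hE' using hWE
  obtain ⟨r, hr⟩ := hW.exists_fibers hα hI hE fun δ hδ γ hγ => hE' δ hδ γ (hWS hγ)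
  -- Raising `t i` to height at least `i` makes the set of these nodes tall.
  have hX : ∀ i, ∃ t, IsStationary {δ ∈ W | r δ = i} → t ∈ hT.pruned ∧ i ≤ hT.height t ∧
      ∀ y ∈ hT.pruned, t ≤ y → IsStationary {δ | (δ ∈ W ∧ r δ = i) ∧ y ∈ b δ} := by
    intro i
    by_cases hi : IsStationary {δ ∈ W | r δ = i}
    · obtain ⟨t, ht, hty⟩ := hT.exists_isStationary_above hκ hκ' hi fun δ hδ => hb δ (hWS hδ.1)
      obtain ⟨t', ht', htt', hit'⟩ := IsKappaTree.exists_mem_pruned_ge' hκ ht i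
      exact ⟨t', fun _ => ⟨ht', hit', fun y hy hy' => hty y hy (htt'.trans hy')⟩⟩
    · obtain ⟨x, -⟩ := IsKappaTree.exists_mem_pruned hT.toIsKappaTree hκ i
      exact ⟨x, fun h => (hi h).elim⟩
  choose t ht using hX
  obtain ⟨t₀, ht₀, hinf⟩ := hT.exists_infinite_le hκ hκ'
    (B := t '' {i | IsStationary {δ ∈ W | r δ = i}}) (fun η => by
      obtain ⟨i, hi, hs⟩ := hr η
      exact ⟨t i, ⟨i, hs, rfl⟩, hi.trans (ht i hs).2.1⟩) (by
      rintro _ ⟨i, hi, rfl⟩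
      exact (ht i hi).1)
  have hinf' : {i | IsStationary {δ ∈ W | r δ = i} ∧ t i ≤ t₀}.Infinite := by
    refine Infinite.of_image t (hinf.mono ?_)
    rintro _ ⟨⟨i, hi, rfl⟩, h⟩
    exact ⟨i, ⟨hi, h⟩, rfl⟩
  let e := hinf'.natEmbedding
  let i : ℕ → OrdBelow κ := fun n => (e n).1
  have hi : Function.Injective i := Subtype.val_injective.comp e.injective
  -- The colour is the index of the fiber containing `δ`; outside the chosen fibers the default
  -- value of `invFun` is harmless.
  refine ⟨fun δ => Function.invFun i (r δ), fun g => ?_⟩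
  obtain ⟨n, hn⟩ := IsKappaTree.IsTall.exists_of_iUnion (hT := hT.toIsKappaTree) hκ
    (ι := ULift.{u} ℕ) (by simpa using hκ')
    (B := fun n => {y | y ∈ hT.pruned ∧ t₀ ≤ y ∧ g y = n.down}) (fun β => by
      obtain ⟨z, h1, h2, h3⟩ := IsKappaTree.exists_mem_pruned_ge' hκ ht₀ β
      exact ⟨z, mem_iUnion.2 ⟨⟨g z⟩, h1, h2, rfl⟩, h3⟩)
  obtain ⟨t₁, ht₁, htB⟩ := hT.exists_dense_above hκ hn
  obtain ⟨z₁, hz₁, htz₁, hz₁h⟩ := IsKappaTree.exists_mem_pruned_ge' hκ ht₁ (hT.height t₀)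
  have ht₀z₁ : t₀ ≤ z₁ := by
    obtain ⟨w, hw, hw'⟩ := htB z₁ hz₁ htz₁
    exact hT.le_of_height_le hw.2.1 hw' hz₁h
  have hXn := (ht (i n.down) (e n.down).2.1).2.2 z₁ hz₁ ((e n.down).2.2.trans ht₀z₁)
  -- If every `δ` fails beyond some `β δ < δ`, press down to a constant `β₀` on stationarily many
  -- branches of the `n`-th fiber through `z₁`. These pass through every pruned node above some
  -- `t₂`, in particular through a node `w` of height at least `β₀` with `g w = n`.
  by_contra! hcon
  choose! β hβ hβg using hcon
  obtain ⟨β₀, hβ₀⟩ := hXn.exists_isStationary_fiber hα hI fun δ hδ => hβ δ (hWS hδ.1.1)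
  obtain ⟨t₂, ht₂, hst⟩ := hT.exists_isStationary_above hκ hκ' hβ₀
    fun δ hδ => hb δ (hWS hδ.1.1.1)
  obtain ⟨z, hz, ht₂z, hzh⟩ := IsKappaTree.exists_mem_pruned_ge' hκ ht₂ (max (hT.height z₁) β₀)
  have hz₁z : z₁ ≤ z := by
    obtain ⟨δ, hδ, hzδ⟩ := (hst z hz ht₂z).nonempty
    exact (hb δ (hWS hδ.1.1.1)).le_of_height_le hδ.1.2 hzδ ((le_max_left _ _).trans hzh)
  obtain ⟨w, ⟨hwP, -, hwg⟩, hzw⟩ := htB z hz (htz₁.trans hz₁z)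
  obtain ⟨δ, ⟨⟨⟨hδW, hδr⟩, -⟩, hδβ⟩, hwδ⟩ := (hst w hwP (ht₂z.trans hzw)).nonempty
  have := hβg δ (hWS hδW) w hwδ
    (hδβ ▸ ((le_max_right _ _).trans hzh).trans (hT.height_mono hzw))
  rw [hδr, hwg, Function.leftInverse_invFun hi] at this
  exact this.false

/-- A Souslin tree has vanishing branches at stationarily many levels. -/
theorem isStationary_vanishing (hκ : κ.IsRegular) (hκ' : ℵ₀ < κ) {C₀ : Set (OrdBelow κ)}
    (hC₀ : IsClub C₀) :
    IsStationary {δ ∈ C₀ | ∃ b, IsVanishingBranch hT.toIsKappaTree δ b} := by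
  have := OrdBelow.noMaxOrder hκ
  intro C hC
  replace hC := hC.inter (OrdBelow.aleph0_lt_cof hκ hκ').ne' hC₀
  set D := C ∩ C₀ with hD
  let Q : Set T := {y | y ∈ hT.pruned ∧ hT.height y ∈ D}
  -- A maximal chain `M` of pruned nodes with heights in the club `D` has no top element. Its
  -- heights have a supremum `δ` in `D`, and a pruned upper bound at level `δ` could be added to
  -- `M`.
  obtain ⟨M, hM⟩ := zorn_subset {A : Set T | A ⊆ Q ∧ IsChain (· ≤ ·) A} (by
    intro c hc hchain
    refine ⟨⋃₀ c, ⟨sUnion_subset fun s hs => (hc hs).1, ?_⟩, fun s hs => subset_sUnion_of_mem hs⟩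
    rintro x ⟨s, hs, hx⟩ y ⟨s', hs', hy⟩ hxy
    rcases hchain.total hs hs' with hss | hss
    · exact (hc hs').2 (hss hx) hy hxy
    · exact (hc hs).2 hx (hss hy) hxy)
  have hins : ∀ z ∈ Q, (∀ x ∈ M, x ≤ z) → z ∈ M := fun z hz hzM =>
    hM.le_of_ge (y := insert z M) ⟨insert_subset hz hM.prop.1,
      hM.prop.2.insert fun x hx _ => .inr (hzM x hx)⟩ (subset_insert _ _) (mem_insert _ _)
  have hle : ∀ x ∈ M, ∀ y ∈ M, hT.height x ≤ hT.height y → x ≤ y := fun x hx y hy h => by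
    rcases hM.prop.2.total hx hy with h' | h'
    · exact h'
    · exact hT.le_of_height_le le_rfl h' h
  have hext : ∀ y ∈ hT.pruned, ∀ γ, ∃ z ∈ Q, y ≤ z ∧ γ ≤ hT.height z := by
    intro y hy γ
    obtain ⟨ε, hε, hγε⟩ := hC.isCofinal (max γ (hT.height y))
    obtain ⟨z, hz, hyz, hzε⟩ := IsKappaTree.exists_mem_pruned_ge hκ hy
      ((le_max_right _ _).trans hγε)
    exact ⟨z, ⟨hz, by rwa [hzε]⟩, hyz, hzε ▸ (le_max_left _ _).trans hγε⟩
  have hnomax : ∀ y ∈ M, ∃ z ∈ M, hT.height y < hT.height z := by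
    intro y hy
    by_contra! hmax
    obtain ⟨γ, hγ⟩ := exists_gt (hT.height y)
    obtain ⟨z, hz, hyz, hγz⟩ := hext y (hM.prop.1 hy).1 γ
    exact (hmax z (hins z hz fun x hx => (hle x hx y hy (hmax x hx)).trans hyz)).not_gt
      (hγ.trans_le hγz)
  have hne : M.Nonempty := by
    by_contra hem
    obtain ⟨γ, -⟩ := hC.isCofinal ⟨0, hκ.ord_pos⟩
    obtain ⟨y, hy, -⟩ := IsKappaTree.exists_mem_pruned hT.toIsKappaTree hκ γ
    obtain ⟨z, hz, -⟩ := hext y hy γ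
    exact hem ⟨z, hins z hz fun x hx => (hem ⟨x, hx⟩).elim⟩
  obtain ⟨β, hβ⟩ := OrdBelow.exists_forall_lt hκ (hT.card_chain_lt M hM.prop.2)
    fun x => hT.height x
  obtain ⟨δ, hδ⟩ := exists_isLUB_of_bddAbove (A := hT.height '' M) ⟨β, by
    rintro _ ⟨x, hx, rfl⟩
    exact (hβ ⟨x, hx⟩).le⟩
  have hδD : δ ∈ D := hC.isLUB_mem (by
    rintro _ ⟨x, hx, rfl⟩
    exact (hM.prop.1 hx).2) (hne.image _) hδ
  have hMδ : ∀ x ∈ M, hT.height x < δ := fun x hx => by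
    obtain ⟨z, hz, hxz⟩ := hnomax x hx
    exact hxz.trans_le (hδ.1 ⟨z, hz, rfl⟩)
  refine ⟨δ, ⟨hδD.2, {x | ∃ y ∈ M, x ≤ y}, ?_⟩, hδD.1⟩
  refine ⟨?_, ?_, ?_, ?_, ?_, ?_⟩
  · rintro x ⟨y, hy, hxy⟩
    exact IsKappaTree.mem_pruned_of_le (hM.prop.1 hy).1 hxy
  · rintro x ⟨y, hy, hxy⟩ x' ⟨y', hy', hxy'⟩
    rcases hM.prop.2.total hy hy' with h | h
    · exact le_or_le (hxy.trans h) hxy'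
    · exact le_or_le hxy (hxy'.trans h)
  · rintro x ⟨y, hy, hxy⟩ z hz
    exact ⟨y, hy, hz.trans hxy⟩
  · rintro x ⟨y, hy, hxy⟩
    exact (hT.height_mono hxy).trans_lt (hMδ y hy)
  · intro γ hγ
    obtain ⟨_, ⟨y, hy, rfl⟩, hγy⟩ := (lt_isLUB_iff hδ).1 hγ
    obtain ⟨x, hx, hxγ⟩ := hT.exists_le_height_eq hγy.le
    exact ⟨x, ⟨y, hy, hx⟩, hxγ⟩
  · intro x hx hxδ
    by_contra! hub
    have hxM : x ∈ M := hins x ⟨hx, by rwa [hxδ]⟩ fun y hy => hub y ⟨y, hy, le_rfl⟩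
    exact (hMδ x hxM).ne hxδ

/-- In a regressive Souslin tree, club many levels of countable cofinality have a vanishing
branch. -/
theorem exists_isClub_vanishing_of_isRegressive (hκ : κ.IsRegular) (hκ' : ℵ₀ < κ)
    (hreg : IsRegressive T) : ∃ C : Set (OrdBelow κ), IsClub C ∧ ∀ δ ∈ C, IsSuccLimit δ.1 →
      ∀ s : ℕ → OrdBelow κ, (∀ n, s n < δ) → (∀ β < δ, ∃ n, β ≤ s n) →
      ∃ b, IsVanishingBranch hT.toIsKappaTree δ b := by
  have := OrdBelow.noMaxOrder hκ
  have hα := OrdBelow.aleph0_lt_cof hκ hκ'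
  have hI := OrdBelow.mk_Iic_lt hκ
  obtain ⟨ρ, hρ, hρ'⟩ := hreg
  choose! u huP v hvP hzu hzv huv hvu using fun z (hz : z ∈ hT.pruned) =>
    hT.exists_incomparable hκ hz
  choose F hF using fun β => OrdBelow.exists_forall_lt hκ
    (IsKappaTree.mk_height_le_lt hT.toIsKappaTree hκ β)
    fun x => max (hT.height (u x)) (hT.height (v x))
  refine ⟨_, isClub_closed_under hα hI F, fun δ hδC hδ s hs hsδ => ?_⟩
  have step : ∀ z : {z // z ∈ hT.pruned ∧ hT.height z < δ}, ∀ n,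
      ∃ z' : {z // z ∈ hT.pruned ∧ hT.height z < δ}, z.1 ≤ z'.1 ∧ s n ≤ hT.height z'.1 ∧
        ∀ x, hT.height x = δ → ρ x ≤ z.1 → ¬ z'.1 ≤ x := by
    rintro ⟨z, hz, hzδ⟩ n
    have hFδ := hδC _ hzδ
    have huδ : hT.height (u z) < δ := ((le_max_left _ _).trans_lt (hF _ ⟨z, le_refl (hT.height z)⟩)).trans hFδ
    have hvδ : hT.height (v z) < δ := ((le_max_right _ _).trans_lt (hF _ ⟨z, le_refl (hT.height z)⟩)).trans hFδ
    -- One of the incomparable extensions `u z`, `v z` works. Otherwise both have extensions `x`,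
    -- `x'` at level `δ` with `ρ x`, `ρ x'` below `z`; regressivity gives `x = x'`, a node above two
    -- incomparable ones.
    obtain ⟨y, hyP, hyδ, hzy, hy⟩ : ∃ y ∈ hT.pruned, hT.height y < δ ∧ z ≤ y ∧
        ∀ x, hT.height x = δ → ρ x ≤ z → ¬ y ≤ x := by
      by_contra! hcon
      obtain ⟨x, hxδ, hxz, hux⟩ := hcon _ (huP z hz) huδ (hzu z hz)
      obtain ⟨x', hxδ', hxz', hvx⟩ := hcon _ (hvP z hz) hvδ (hzv z hz)
      have hlim : ht x = δ.1 := congrArg Subtype.val hxδ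
      have hlim' : ht x' = δ.1 := congrArg Subtype.val hxδ'
      have hlt : ∀ x'', hT.height x'' = δ → z ≤ x'' → z < x'' := fun x'' h1 h2 =>
        lt_of_le_of_ne h2 (by rintro rfl; exact hzδ.ne h1)
      have hxx : x = x' := hρ' x x' (hlim ▸ hδ) (hlim.trans hlim'.symm)
        (hxz.trans_lt (hlt x' hxδ' ((hzv z hz).trans hvx)))
        (hxz'.trans_lt (hlt x hxδ ((hzu z hz).trans hux)))
      subst hxx
      rcases le_or_le hux hvx with h | h
      · exact huv z hz h
      · exact hvu z hz h
    obtain ⟨z', hz', hyz', hz'h⟩ := IsKappaTree.exists_mem_pruned_ge hκ hyP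
      (le_max_left (hT.height y) (s n))
    exact ⟨⟨z', hz', hz'h.trans_lt (max_lt hyδ (hs n))⟩, hzy.trans hyz',
      (le_max_right _ _).trans_eq hz'h.symm,
      fun x h1 h2 h3 => hy x h1 h2 (hyz'.trans h3)⟩
  choose nxt hnxt hnxts hnxtρ using step
  obtain ⟨z₀, hz₀P, hz₀⟩ := IsKappaTree.exists_mem_pruned hT.toIsKappaTree hκ (s 0)
  let z : ℕ → {z // z ∈ hT.pruned ∧ hT.height z < δ} :=
    fun n => Nat.rec ⟨z₀, hz₀P, hz₀ ▸ hs 0⟩ (fun n y => nxt y n) n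
  have hz : ∀ n, z (n + 1) = nxt (z n) n := fun n => rfl
  have hzmono : Monotone fun n => (z n).1 := monotone_nat_of_le_succ fun n => by
    rw [hz]; exact hnxt _ _
  have hzs : ∀ n, s n ≤ hT.height (z (n + 1)).1 := fun n => by rw [hz]; exact hnxts _ _
  refine ⟨{x | ∃ n, x ≤ (z n).1}, ?_, ?_, ?_, ?_, ?_, ?_⟩
  · rintro x ⟨n, hn⟩
    exact IsKappaTree.mem_pruned_of_le (z n).2.1 hn
  · rintro x ⟨n, hn⟩ y ⟨m, hm⟩
    exact le_or_le (hn.trans (hzmono (le_max_left n m))) (hm.trans (hzmono (le_max_right n m)))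
  · rintro x ⟨n, hn⟩ y hy
    exact ⟨n, hy.trans hn⟩
  · rintro x ⟨n, hn⟩
    exact (hT.height_mono hn).trans_lt (z n).2.2
  · intro β hβ
    obtain ⟨n, hn⟩ := hsδ β hβ
    obtain ⟨x, hx, hxβ⟩ := hT.exists_le_height_eq (hn.trans (hzs n))
    exact ⟨x, ⟨n + 1, hx⟩, hxβ⟩
  · intro x hxP hxδ
    by_contra! hub
    have hlim : ht x = δ.1 := congrArg Subtype.val hxδ
    have hρx := hρ x (hlim ▸ hδ)
    -- A bound `x` has `ρ x` below some stage of the construction, and the next stage was chosen not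
    -- to lie below `x`.
    obtain ⟨n, hn⟩ := hsδ (hT.height (ρ x)) (hxδ ▸ hT.height_lt hρx)
    have hle : ρ x ≤ (z (n + 1)).1 :=
      hT.le_of_height_le hρx.le (hub _ ⟨n + 1, le_rfl⟩) (hn.trans (hzs n))
    refine hnxtρ (z (n + 1)) (n + 1) x hxδ hle ?_
    exact hub _ ⟨n + 2, le_rfl⟩

end IsSouslin

/-- Coherent trees are regressive. -/
theorem IsCoherent.isRegressive (h : IsCoherent T) : IsRegressive T := by
  classical
  obtain ⟨e, hle, hfin⟩ := h
  -- One reference node per level. At limit height, `ρ x` is taken high enough below `x` that all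
  -- the finitely many disagreements with the reference node are below its height.
  let base : Ordinal.{u} → T → T := fun α x =>
    if h : ∃ y : T, ht y = α then h.choose else x
  have hbase : ∀ x, ht (base (ht x) x) = ht x := fun x => by
    have h : ∃ y : T, ht y = ht x := ⟨x, rfl⟩
    simp only [base, dif_pos h]
    exact h.choose_spec
  have hbase_eq : ∀ x y : T, ht x = ht y → base (ht x) x = base (ht y) y := fun x y hxy => by
    have h : ∃ z : T, ht z = ht y := ⟨y, rfl⟩
    simp only [hxy, base, dif_pos h]
  have key : ∀ x : T, ∃ y, IsSuccLimit (ht x) → y < x ∧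
      ∀ ξ, ht y ≤ ξ → ξ < ht x → e x ξ = e (base (ht x) x) ξ := by
    intro x
    by_cases hx : IsSuccLimit (ht x)
    · obtain ⟨β, hβ, hβ'⟩ : ∃ β < ht x, ∀ ξ, β ≤ ξ → ξ < ht x →
          e x ξ = e (base (ht x) x) ξ := by
        have hf := hfin x (base (ht x) x) (hbase x).symm
        obtain ⟨β, hβ, hβ'⟩ : ∃ β < ht x, ∀ ξ ∈ {ξ | ξ < ht x ∧ e x ξ ≠ e (base (ht x) x) ξ},
            ξ < β := by
          refine Set.Finite.induction_on_subset (motive := fun A _ => ∃ β < ht x, ∀ ξ ∈ A, ξ < β)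
            _ hf ⟨0, hx.bot_lt, by simp⟩ ?_
          rintro ξ A hξ - - ⟨β, hβ, hA⟩
          refine ⟨max β (succ ξ), max_lt hβ (hx.succ_lt hξ.1), ?_⟩
          rintro ζ (rfl | hζ)
          · exact (lt_succ ζ).trans_le (le_max_right _ _)
          · exact (hA ζ hζ).trans_le (le_max_left _ _)
        refine ⟨β, hβ, fun ξ h1 h2 => ?_⟩
        by_contra hne
        exact (hβ' ξ ⟨h2, hne⟩).not_ge h1
      obtain ⟨y, hy, rfl⟩ := exists_lt_ht_eq hβ
      exact ⟨y, fun _ => ⟨hy, hβ'⟩⟩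
    · exact ⟨x, fun h => (hx h).elim⟩
  choose ρ hρ using key
  refine ⟨ρ, fun x hx => (hρ x hx).1, fun x y hx hxy hρxy hρyx => ?_⟩
  -- Below the height of `ρ y` both functions extend `ρ y`; from there on both agree with the
  -- reference node of their level.
  have aux : ∀ x y : T, IsSuccLimit (ht x) → ht x = ht y → ρ y < x →
      ht (ρ x) ≤ ht (ρ y) → x = y := by
    intro x y hx hxy hyx hxy'
    have hy : IsSuccLimit (ht y) := hxy ▸ hx
    have heq : ∀ ξ < ht x, e x ξ = e y ξ := by
      intro ξ hξ
      rcases lt_or_ge ξ (ht (ρ y)) with h | h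
      · rw [← ((hle _ _).1 hyx.le).2 ξ h, ((hle _ _).1 (hρ y hy).1.le).2 ξ h]
      · rw [(hρ x hx).2 ξ (hxy'.trans h) hξ, (hρ y hy).2 ξ h (hxy ▸ hξ), hbase_eq x y hxy]
    exact le_antisymm ((hle _ _).2 ⟨hxy.le, heq⟩)
      ((hle _ _).2 ⟨hxy.ge, fun ξ hξ => (heq ξ (hxy ▸ hξ)).symm⟩)
  rcases le_total (ht (ρ x)) (ht (ρ y)) with h | h
  · exact aux x y hx hxy hρyx h
  · exact (aux y x (hxy ▸ hx) hxy.symm hρxy h).symm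

end SetTree

/-! ### Topological properties of the space of a ladder system -/

namespace LadderSystem

open Set Topology

variable {κ : Cardinal.{u}} {S : Set (OrdBelow κ)} (L : LadderSystem κ S)

theorem isEndSegment_inter_Ici (δ : S) {β : OrdBelow κ} (hβ : β < δ) :
    IsEndSegment (L.ladder δ ∩ Ici β) (L.ladder δ) where
  subset := inter_subset_left
  upward _ hα _ hγ h := ⟨hγ, hα.2.trans h⟩
  nonempty _ := L.cofinal δ β hβ

variable {L}

theorem isOpen_of_exists_lt {U : Set L.Space}
    (h : ∀ δ : S, Space.one δ ∈ U → ∃ β < (δ : OrdBelow κ), ∀ α ∈ L.ladder δ, β ≤ α →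
      Space.zero α ∈ U) : IsOpen U := fun δ hδ => by
  obtain ⟨β, hβ, hU⟩ := h δ hδ
  exact ⟨_, L.isEndSegment_inter_Ici δ hβ, fun α hα => hU α hα.1 hα.2⟩

theorem exists_lt_of_isOpen {U : Set L.Space} (hU : IsOpen U) {δ : S} (hδ : Space.one δ ∈ U)
    (hbot : ∃ β, β < (δ : OrdBelow κ)) :
    ∃ β < (δ : OrdBelow κ), ∀ α ∈ L.ladder δ, β ≤ α → Space.zero α ∈ U := by
  obtain ⟨A, hA, hAU⟩ := hU δ hδ
  obtain ⟨β, hβ⟩ := hbot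
  obtain ⟨α, hα, -⟩ := L.cofinal δ β hβ
  obtain ⟨a, ha⟩ := hA.nonempty ⟨α, hα⟩
  exact ⟨a, L.lt_of_mem δ a (hA.subset ha), fun α hα h => hAU α (hA.upward a ha α hα h)⟩

theorem isOpen_singleton_zero (α : OrdBelow κ) : IsOpen {(Space.zero α : L.Space)} :=
  fun _ hδ => by cases hδ

/-- The basic neighbourhood of `(δ, 1)` given by the end segment of the ladder from `β` on. -/
def basicNhd (L : LadderSystem κ S) (δ : S) (β : OrdBelow κ) : Set L.Space :=
  insert (Space.one δ) (Space.zero '' (L.ladder δ ∩ Ici β))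

theorem one_mem_basicNhd {δ δ' : S} {β : OrdBelow κ} :
    Space.one δ' ∈ L.basicNhd δ β ↔ δ' = δ := by
  simp [basicNhd]

theorem zero_mem_basicNhd {δ : S} {α β : OrdBelow κ} :
    Space.zero α ∈ L.basicNhd δ β ↔ α ∈ L.ladder δ ∧ β ≤ α := by
  simp [basicNhd]

theorem isOpen_basicNhd {δ : S} {β : OrdBelow κ} (hβ : β < δ) : IsOpen (L.basicNhd δ β) := by
  refine isOpen_of_exists_lt fun δ' hδ' => ?_
  obtain rfl := one_mem_basicNhd.1 hδ'
  exact ⟨β, hβ, fun α hα h => zero_mem_basicNhd.2 ⟨hα, h⟩⟩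

/-- The sequence is cofinal in `δ` and need not lie in the ladder, whose order type may exceed `ω`.
-/
theorem hasBasis_nhds_one {δ : S} {s : ℕ → OrdBelow κ} (hs : ∀ n, s n < δ)
    (hsδ : ∀ β < (δ : OrdBelow κ), ∃ n, β ≤ s n) :
    (𝓝 (Space.one δ : L.Space)).HasBasis (fun _ => True) fun n => L.basicNhd δ (s n) := by
  refine ⟨fun U => ⟨fun hU => ?_, fun ⟨n, _, hn⟩ => ?_⟩⟩
  · obtain ⟨V, hVU, hV, hδV⟩ := mem_nhds_iff.1 hU
    obtain ⟨β, hβ, hβV⟩ := exists_lt_of_isOpen hV hδV ⟨_, hs 0⟩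
    obtain ⟨n, hn⟩ := hsδ β hβ
    refine ⟨n, trivial, Subset.trans ?_ hVU⟩
    rintro _ (rfl | ⟨α, ⟨hα, h⟩, rfl⟩)
    · exact hδV
    · exact hβV α hα (hn.trans h)
  · exact Filter.mem_of_superset ((isOpen_basicNhd (hs n)).mem_nhds (one_mem_basicNhd.2 rfl)) hn

theorem firstCountableTopology
    (hs : ∀ δ : S, ∃ s : ℕ → OrdBelow κ, (∀ n, s n < δ) ∧ ∀ β < (δ : OrdBelow κ), ∃ n, β ≤ s n) :
    FirstCountableTopology L.Space where
  nhds_generated_countable x := by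
    cases x with
    | zero α =>
      rw [(isOpen_singleton_iff_nhds_eq_pure _).1 (isOpen_singleton_zero α)]
      infer_instance
    | one δ =>
      obtain ⟨s, hs, hsδ⟩ := hs δ
      exact (hasBasis_nhds_one hs hsδ).isCountablyGenerated

section AlmostDisjoint

variable (hlim : ∀ δ : S, ∀ β < (δ : OrdBelow κ), ∃ γ, β < γ ∧ γ < (δ : OrdBelow κ))
  (hbot : ∀ δ : S, ∃ β, β < (δ : OrdBelow κ))
  (hdisj : ∀ δ δ' : S, δ ≠ δ' → ∃ β < (δ' : OrdBelow κ), ∀ α ∈ L.ladder δ, α ∈ L.ladder δ' → α < β)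

include hlim hbot in
theorem isClopen_singleton_zero (α : OrdBelow κ) : IsClopen {(Space.zero α : L.Space)} := by
  refine ⟨⟨isOpen_of_exists_lt fun δ _ => ?_⟩, isOpen_singleton_zero α⟩
  by_cases hα : α < δ
  · obtain ⟨γ, hγ, hγδ⟩ := hlim δ α hα
    refine ⟨γ, hγδ, fun α' _ h h' => ?_⟩
    cases h'
    exact h.not_gt hγ
  · obtain ⟨β, hβ⟩ := hbot δ
    refine ⟨β, hβ, fun α' hα' _ h' => ?_⟩
    cases h'
    exact hα (L.lt_of_mem δ α hα')

include hdisj in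
theorem isClopen_basicNhd {δ : S} {β : OrdBelow κ} (hβ : β < δ) :
    IsClopen (L.basicNhd δ β) := by
  refine ⟨⟨isOpen_of_exists_lt fun δ' hδ' => ?_⟩, isOpen_basicNhd hβ⟩
  obtain ⟨γ, hγ, h⟩ := hdisj δ δ' fun h => hδ' (one_mem_basicNhd.2 h.symm)
  exact ⟨γ, hγ, fun α hα hγα hmem => (h α (zero_mem_basicNhd.1 hmem).1 hα).not_ge hγα⟩

include hlim hbot hdisj

theorem t2Space : T2Space L.Space := by
  have : TotallySeparatedSpace L.Space := by
    rw [totallySeparatedSpace_iff_exists_isClopen]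
    intro x y hxy
    cases x with
    | zero α => exact ⟨_, isClopen_singleton_zero hlim hbot α, rfl, fun h => hxy h.symm⟩
    | one δ =>
      obtain ⟨β, hβ⟩ := hbot δ
      cases y with
      | zero α => exact ⟨_, (isClopen_singleton_zero hlim hbot α).compl, hxy, fun h => h rfl⟩
      | one δ' =>
        exact ⟨_, isClopen_basicNhd hdisj hβ, one_mem_basicNhd.2 rfl, fun h =>
          hxy (congrArg Space.one (one_mem_basicNhd.1 h).symm)⟩
  infer_instance

theorem regularSpace : RegularSpace L.Space := by
  refine RegularSpace.of_exists_mem_nhds_isClosed_subset fun x U hU => ?_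
  cases x with
  | zero α =>
    exact ⟨_, (isOpen_singleton_zero α).mem_nhds rfl, (isClopen_singleton_zero hlim hbot α).1,
      singleton_subset_iff.2 (mem_of_mem_nhds hU)⟩
  | one δ =>
    obtain ⟨V, hVU, hV, hδV⟩ := mem_nhds_iff.1 hU
    obtain ⟨β, hβ, hβV⟩ := exists_lt_of_isOpen hV hδV (hbot δ)
    refine ⟨_, (isOpen_basicNhd hβ).mem_nhds (one_mem_basicNhd.2 rfl),
      (isClopen_basicNhd hdisj hβ).1, Subset.trans ?_ hVU⟩
    rintro _ (rfl | ⟨α, ⟨hα, h⟩, rfl⟩)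
    · exact hδV
    · exact hβV α hα h

end AlmostDisjoint

/-- If some colouring of `S` is not eventually dominated along all ladders by any colouring of `κ`,
then the space of the ladder system is not countably metacompact. -/
theorem not_countablyMetacompact (hbot : ∀ δ : S, ∃ β, β < (δ : OrdBelow κ)) (f : S → ℕ)
    (hf : ∀ g : OrdBelow κ → ℕ, ∃ δ : S, ∀ β < (δ : OrdBelow κ), ∃ α ∈ L.ladder δ,
      β ≤ α ∧ g α ≤ f δ) : ¬ CountablyMetacompact L.Space := by
  intro hL
  -- For open `U n` shrinking to the empty set, let `g α` be an index at which `(α, 0)` has left.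
  -- Then `U (f δ)` contains an end of the ladder at `δ`, so `f δ < g α` on that end.
  obtain ⟨U, hU, hUo, hUe, hDU⟩ := hL (fun n => Space.one '' {δ | n ≤ f δ})
    (fun m n hmn => image_mono fun δ (hδ : n ≤ f δ) => hmn.trans hδ)
    (fun n => ⟨fun δ _ => ⟨_, IsEndSegment.refl _, by rintro α - ⟨δ, -, h⟩; cases h⟩⟩)
    (by
      refine eq_empty_of_forall_notMem fun x hx => ?_
      obtain ⟨δ, -, rfl⟩ := mem_iInter.1 hx 0
      obtain ⟨δ', h, h'⟩ := mem_iInter.1 hx (f δ + 1)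
      cases h'
      exact (Nat.lt_irrefl _ h))
  have hg : ∀ α, ∃ n, (Space.zero α : L.Space) ∉ U n := fun α => by
    by_contra! h
    exact (hUe ▸ mem_iInter.2 h : Space.zero α ∈ (∅ : Set L.Space)).elim
  choose g hg using hg
  obtain ⟨δ, hδ⟩ := hf g
  obtain ⟨β, hβ, hβU⟩ := exists_lt_of_isOpen (hUo (f δ)) (hDU (f δ) ⟨δ, le_refl (f δ), rfl⟩) (hbot δ)
  obtain ⟨α, hα, hβα, hgα⟩ := hδ β hβ
  exact hg α (hU hgα (hβU α hα hβα))

end LadderSystem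

/-! ### Limit ordinals and points of countable cofinality. -/

namespace OrdBelow

open Order Set

variable {κ : Cardinal.{u}}

theorem succ_lt (hκ : κ.IsRegular) (β : OrdBelow κ) : succ β.1 < κ.ord :=
  (isSuccLimit_ord hκ.aleph0_le).succ_lt β.2

theorem isClub_isSuccLimit (hκ : κ.IsRegular) (hκ' : ℵ₀ < κ) :
    IsClub {δ : OrdBelow κ | IsSuccLimit δ.1} := by
  have := noMaxOrder hκ
  have hα := aleph0_lt_cof hκ hκ'
  convert! (isClub_closed_under hα (mk_Iic_lt hκ) fun β => ⟨succ β.1, succ_lt hκ β⟩).inter hα.ne'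
    (isClub_Ioi ⟨0, hκ.ord_pos⟩) using 1
  ext δ
  constructor
  · intro h
    exact ⟨fun β hβ => h.succ_lt hβ, h.bot_lt⟩
  · rintro ⟨h1, h2⟩
    refine (isSuccLimit_iff _).2 ⟨fun h => (show (0 : Ordinal) < δ.1 from h2).not_ge (isMin_iff_eq_bot.1 h).le, ?_⟩
    refine isSuccPrelimit_of_succ_lt fun β hβ => ?_
    exact h1 ⟨β, hβ.trans δ.2⟩ hβ

theorem exists_seq_of_mem_cofOmega {δ : OrdBelow κ} (hδ : δ ∈ cofOmega κ) :
    ∃ s : ℕ → OrdBelow κ, StrictMono s ∧ (∀ n, s n < δ) ∧ ∀ β < δ, ∃ n, β ≤ s n := by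
  have hω : (Ordinal.cof δ.1).ord = Ordinal.omega0 := by
    rw [show Ordinal.cof δ.1 = ℵ₀ from hδ, ord_aleph0]
  obtain ⟨f, hf⟩ := Ordinal.exists_isFundamentalSeq hω
  refine ⟨fun n => ⟨(f ⟨n, Ordinal.natCast_lt_omega0 n⟩).1,
    lt_trans (mem_Iio.1 (f ⟨n, Ordinal.natCast_lt_omega0 n⟩).2) δ.2⟩, fun m n h => ?_, fun n => ?_, fun β hβ => ?_⟩
  · exact hf.strictMono (Subtype.mk_lt_mk.2 (Nat.cast_lt.2 h))
  · exact (f ⟨n, Ordinal.natCast_lt_omega0 n⟩).2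
  · obtain ⟨_, ⟨⟨m, hm⟩, rfl⟩, hle⟩ := hf.isCofinal_range ⟨β.1, hβ⟩
    obtain ⟨n, rfl⟩ := Ordinal.lt_omega0.1 hm
    exact ⟨n, hle⟩

theorem isSuccLimit_of_mem_cofOmega {δ : OrdBelow κ} (hδ : δ ∈ cofOmega κ) :
    IsSuccLimit δ.1 :=
  Ordinal.one_lt_cof_iff.1 (by
    rw [show Ordinal.cof δ.1 = ℵ₀ from hδ]
    exact one_lt_aleph0)

theorem isStationary_cofOmega (hκ : κ.IsRegular) (hκ' : ℵ₀ < κ) :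
    IsStationary (cofOmega κ) := by
  have := noMaxOrder hκ
  intro C hC
  choose F hF using fun x : OrdBelow κ => exists_gt x
  choose G hG hFG using fun x => hC.isCofinal (F x)
  let s : ℕ → OrdBelow κ := fun n => G^[n + 1] ⟨0, hκ.ord_pos⟩
  have hs : ∀ n, s (n + 1) = G (s n) := fun n => Function.iterate_succ_apply' G _ _
  have hmono : StrictMono s := strictMono_nat_of_lt_succ fun n => by
    rw [hs]; exact (hF _).trans_le (hFG _)
  have hsC : ∀ n, s n ∈ C := fun n => by
    simp only [s, Function.iterate_succ_apply']; exact hG _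
  obtain ⟨δ, hδ⟩ := exists_isLUB_range_nat (aleph0_lt_cof hκ hκ') s
  refine ⟨δ, ?_, hC.isLUB_mem (by rintro _ ⟨n, rfl⟩; exact hsC n) (range_nonempty s) hδ⟩
  have hsup : ⨆ n, (s n).1 = δ.1 := by
    refine le_antisymm (Ordinal.iSup_le fun n => hδ.1 ⟨n, rfl⟩) ?_
    by_contra! hlt
    have hub : δ ≤ ⟨⨆ n, (s n).1, hlt.trans δ.2⟩ := hδ.2 (by
      rintro _ ⟨n, rfl⟩
      exact Ordinal.le_iSup (fun n => (s n).1) n)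
    exact hlt.not_ge hub
  have hcof := Ordinal.lift_cof_iSup (f := fun n => (s n).1) fun m n h => hmono h
  rw [hsup] at hcof
  show Ordinal.cof δ.1 = ℵ₀
  simpa using hcof

end OrdBelow

/-! ### Coding nodes by ordinals and assembling the ladder systems. -/

namespace SetTree

open Order Set

variable {κ : Cardinal.{u}} {T : Type u} [PartialOrder T] [IsSetTree T]

theorem IsKappaTree.mk_le (hT : IsKappaTree κ T) (hκ : κ.IsRegular) : #T ≤ κ := by
  have huniv : (univ : Set T) =
      ⋃ i : κ.ord.ToType, level T ((Ordinal.ToType.mk.symm i : Iio _) : Ordinal.{u}) := by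
    refine (eq_univ_of_forall fun x => mem_iUnion.2
      ⟨Ordinal.ToType.mk ⟨ht x, hT.ht_lt x⟩, ?_⟩).symm
    simp [level]
  rw [← mk_univ, huniv]
  refine (mk_iUnion_le _).trans ?_
  rw [Cardinal.mk_toType, card_ord]
  exact mul_le_of_le hκ.aleph0_le le_rfl
    (ciSup_le' fun i => (hT.card_level_lt _ (Ordinal.ToType.mk.symm i).2).le)

/-- The nodes of a `κ`-tree can be coded by limit ordinals below `κ`. -/
theorem IsKappaTree.exists_coding (hT : IsKappaTree κ T) (hκ : κ.IsRegular) (hκ' : ℵ₀ < κ) :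
    ∃ ψ : T → OrdBelow κ, Function.Injective ψ ∧ ∀ y, IsSuccLimit (ψ y).1 := by
  have h1 : Cardinal.lift.{u + 1} #T ≤
      Cardinal.lift.{u} #{δ : OrdBelow κ | IsSuccLimit δ.1} := by
    rw [Cardinal.lift_id'.{u, u + 1}]
    calc Cardinal.lift.{u + 1} #T ≤ Cardinal.lift.{u + 1} κ := Cardinal.lift_le.2 (hT.mk_le hκ)
      _ = Order.cof (OrdBelow κ) := (OrdBelow.cof_eq hκ).symm
      _ ≤ _ := cof_le (OrdBelow.isClub_isSuccLimit hκ hκ').isCofinal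
  obtain ⟨e⟩ := Cardinal.lift_mk_le'.1 h1
  exact ⟨fun y => (e y).1, Subtype.val_injective.comp e.injective, fun y => (e y).2⟩

/-- A coding `ψ` of the nodes of a tree by ordinals matches the heights at `δ` if the nodes of
height below `δ` are coded, level by level, by ordinals below `δ`, and vice versa. -/
structure MatchesAt (hT : IsKappaTree κ T) (ψ : T → OrdBelow κ) (δ : OrdBelow κ) : Prop where
  isSuccLimit : IsSuccLimit δ.1
  code_lt : ∀ β < δ, ∃ γ < δ, ∀ y, hT.height y ≤ β → ψ y < γ
  height_lt : ∀ β < δ, ∃ γ < δ, ∀ y, ψ y ≤ β → hT.height y < γ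

theorem IsKappaTree.exists_isClub_matchesAt (hT : IsKappaTree κ T) (hκ : κ.IsRegular)
    (hκ' : ℵ₀ < κ) {ψ : T → OrdBelow κ} (hψ : Function.Injective ψ) :
    ∃ C, IsClub C ∧ ∀ δ ∈ C, MatchesAt hT ψ δ := by
  have := OrdBelow.noMaxOrder hκ
  have hα := OrdBelow.aleph0_lt_cof hκ hκ'
  have hI := OrdBelow.mk_Iic_lt hκ
  choose F hF using fun β => OrdBelow.exists_forall_lt hκ (hT.mk_height_le_lt hκ β)
    fun y => ψ y
  choose G hG using fun β => OrdBelow.exists_forall_lt hκ (ι := {y // ψ y ≤ β}) (by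
      have h1 : Cardinal.lift.{u + 1} #{y // ψ y ≤ β} ≤ Cardinal.lift.{u} #(Iic β) :=
        Cardinal.lift_mk_le'.2 ⟨⟨fun y => ⟨ψ y.1, y.2⟩, fun y z h =>
          Subtype.ext (hψ (congrArg Subtype.val h))⟩⟩
      rw [Cardinal.lift_id'.{u, u + 1}] at h1
      have h2 := h1.trans_lt (hI β)
      rwa [OrdBelow.cof_eq hκ, Cardinal.lift_lt] at h2)
    fun y => hT.height y.1
  refine ⟨_, ((isClub_closed_under hα hI F).inter hα.ne' (isClub_closed_under hα hI G)).inter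
    hα.ne' (OrdBelow.isClub_isSuccLimit hκ hκ'), ?_⟩
  rintro δ ⟨⟨hF', hG'⟩, hlim⟩
  exact ⟨hlim, fun β hβ => ⟨F β, hF' β hβ, fun y hy => hF β ⟨y, hy⟩⟩,
    fun β hβ => ⟨G β, hG' β hβ, fun y hy => hG β ⟨y, hy⟩⟩⟩

namespace IsVanishingBranch

variable {hT : IsKappaTree κ T} {ψ : T → OrdBelow κ} {δ : OrdBelow κ} {b : Set T}

theorem code_lt (hb : IsVanishingBranch hT δ b) (hδ : MatchesAt hT ψ δ) :
    ∀ α ∈ ψ '' b, α < δ := by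
  rintro _ ⟨y, hy, rfl⟩
  obtain ⟨γ, hγ, h⟩ := hδ.code_lt _ (hb.height_lt y hy)
  exact (h y le_rfl).trans hγ

theorem exists_le_code (hb : IsVanishingBranch hT δ b) (hδ : MatchesAt hT ψ δ) {β : OrdBelow κ}
    (hβ : β < δ) : ∃ α ∈ ψ '' b, β ≤ α := by
  obtain ⟨γ, hγ, h⟩ := hδ.height_lt β hβ
  obtain ⟨y, hy, rfl⟩ := hb.exists_height_eq γ hγ
  refine ⟨ψ y, ⟨y, hy, rfl⟩, ?_⟩
  by_contra! hlt
  exact (h y hlt.le).false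

/-- The node `x` of `b` at height `δ'` fails to bound some `y₀` in `b'`. A common node cannot be
above `y₀`, so its height is at most that of `y₀`, and matching at `δ'` bounds its code. -/
theorem exists_bound (hψ : Function.Injective ψ) (hb : IsVanishingBranch hT δ b) {δ' : OrdBelow κ}
    {b' : Set T} (hb' : IsVanishingBranch hT δ' b') (hδ' : MatchesAt hT ψ δ') (h : δ' < δ) :
    ∃ β < δ', ∀ α ∈ ψ '' b, α ∈ ψ '' b' → α < β := by
  obtain ⟨x, hx, hxδ'⟩ := hb.exists_height_eq δ' h
  obtain ⟨y₀, hy₀, hy₀x⟩ := hb'.not_bounded x (hb.subset hx) hxδ'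
  obtain ⟨γ, hγ, hγ'⟩ := hδ'.code_lt _ (hb'.height_lt y₀ hy₀)
  refine ⟨γ, hγ, ?_⟩
  rintro _ ⟨y, hy, rfl⟩ ⟨y', hy', hyy'⟩
  obtain rfl := hψ hyy'
  refine hγ' y' (hT.height_mono ?_)
  refine (hb'.chain y' hy' y₀ hy₀).resolve_right fun hle => hy₀x (hle.trans ?_)
  exact hb.le_of_height_le hy hx ((hb'.height_lt y' hy').le.trans_eq hxδ'.symm)

end IsVanishingBranch

theorem IsSouslin.exists_coloring_of_code (hT : IsSouslin κ T) (hκ : κ.IsRegular) (hκ' : ℵ₀ < κ)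
    {ψ : T → OrdBelow κ} {S : Set (OrdBelow κ)} (hS : IsStationary S)
    (hSψ : ∀ δ ∈ S, MatchesAt hT.toIsKappaTree ψ δ) {b : OrdBelow κ → Set T}
    (hb : ∀ δ ∈ S, IsVanishingBranch hT.toIsKappaTree δ (b δ)) :
    ∃ f : OrdBelow κ → ℕ, ∀ g : OrdBelow κ → ℕ, ∃ δ ∈ S, ∀ β < δ, ∃ α ∈ ψ '' b δ,
      β ≤ α ∧ g α ≤ f δ := by
  obtain ⟨f, hf⟩ := hT.exists_coloring hκ hκ' hS
    (fun δ hδ => ⟨⟨0, hκ.ord_pos⟩, (hSψ δ hδ).isSuccLimit.bot_lt⟩) hb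
  refine ⟨f, fun g => ?_⟩
  obtain ⟨δ, hδ, h⟩ := hf (g ∘ ψ)
  refine ⟨δ, hδ, fun β hβ => ?_⟩
  obtain ⟨γ, hγ, hγ'⟩ := (hSψ δ hδ).height_lt β hβ
  obtain ⟨y, hy, hγy, hgy⟩ := h γ hγ
  refine ⟨ψ y, ⟨y, hy, rfl⟩, ?_, hgy⟩
  by_contra! hlt
  exact (hγ' y hlt.le).not_ge hγy

theorem exists_between_of_isSuccLimit {δ : OrdBelow κ} (hδ : IsSuccLimit δ.1) :
    ∀ β < δ, ∃ γ, β < γ ∧ γ < δ := fun β hβ =>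
  ⟨⟨succ β.1, (hδ.succ_lt hβ).trans δ.2⟩, lt_succ β.1, hδ.succ_lt hβ⟩

theorem exists_lt_of_isSuccLimit {δ : OrdBelow κ} (hδ : IsSuccLimit δ.1) : ∃ β, β < δ :=
  ⟨⟨0, hδ.bot_lt.trans δ.2⟩, hδ.bot_lt⟩

/-- A `κ`-Souslin tree gives rise to a ladder system whose space is a regular Hausdorff space that
is not countably metacompact. -/
theorem IsSouslin.exists_ladderSystem (hT : IsSouslin κ T) (hκ : κ.IsRegular) (hκ' : ℵ₀ < κ) :
    ∃ (S : Set (OrdBelow κ)) (L : LadderSystem κ S),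
      T2Space L.Space ∧ RegularSpace L.Space ∧ ¬ CountablyMetacompact L.Space := by
  obtain ⟨ψ, hψ, -⟩ := hT.exists_coding hκ hκ'
  obtain ⟨C, hC, hCψ⟩ := hT.exists_isClub_matchesAt hκ hκ' hψ
  obtain ⟨S, hSC, hS, hSb⟩ : ∃ S ⊆ C, IsStationary S ∧
      ∀ δ ∈ S, ∃ b, IsVanishingBranch hT.toIsKappaTree δ b :=
    ⟨_, fun _ h => h.1, hT.isStationary_vanishing hκ hκ' hC, fun _ h => h.2⟩
  choose! b hb using hSb
  obtain ⟨f, hf⟩ := hT.exists_coloring_of_code hκ hκ' hS (fun δ hδ => hCψ δ (hSC hδ)) hb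
  have hm : ∀ δ : S, MatchesAt hT.toIsKappaTree ψ δ.1 := fun δ => hCψ δ (hSC δ.2)
  let L : LadderSystem κ S :=
    { isStationary := hS
      ladder := fun δ => ψ '' b δ
      lt_of_mem := fun δ => (hb δ δ.2).code_lt (hm δ)
      cofinal := fun δ _ hβ => (hb δ δ.2).exists_le_code (hm δ) hβ }
  have hlim : ∀ δ : S, ∀ β < (δ : OrdBelow κ), ∃ γ, β < γ ∧ γ < (δ : OrdBelow κ) :=
    fun δ => exists_between_of_isSuccLimit (hm δ).isSuccLimit
  have hbot : ∀ δ : S, ∃ β, β < (δ : OrdBelow κ) :=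
    fun δ => exists_lt_of_isSuccLimit (hm δ).isSuccLimit
  have hdisj : ∀ δ δ' : S, δ ≠ δ' → ∃ β < (δ' : OrdBelow κ),
      ∀ α ∈ L.ladder δ, α ∈ L.ladder δ' → α < β := by
    intro δ δ' hne
    rcases lt_or_gt_of_ne (Subtype.coe_ne_coe.2 hne) with h | h
    · exact ⟨δ, h, fun α hα _ => L.lt_of_mem δ α hα⟩
    · exact (hb δ δ.2).exists_bound hψ (hb δ' δ'.2) (hm δ') h
  refine ⟨S, L, LadderSystem.t2Space hlim hbot hdisj, LadderSystem.regularSpace hlim hbot hdisj,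
    LadderSystem.not_countablyMetacompact hbot (fun δ => f δ) fun g => ?_⟩
  obtain ⟨δ, hδ, h⟩ := hf g
  exact ⟨⟨δ, hδ⟩, h⟩

/-- A regressive `κ`-Souslin tree gives rise to a ladder system over `E^κ_ω` whose space is a
first countable regular Hausdorff space that is not countably metacompact. -/
theorem IsSouslin.exists_ladderSystem_cofOmega (hT : IsSouslin κ T) (hκ : κ.IsRegular)
    (hκ' : ℵ₀ < κ) (hreg : IsRegressive T) :
    ∃ L : LadderSystem κ (cofOmega κ),
      T2Space L.Space ∧ RegularSpace L.Space ∧ ¬ CountablyMetacompact L.Space ∧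
        FirstCountableTopology L.Space := by
  classical
  have hα := OrdBelow.aleph0_lt_cof hκ hκ'
  obtain ⟨ψ, hψ, hψlim⟩ := hT.exists_coding hκ hκ'
  obtain ⟨C₀, hC₀, hCψ⟩ := hT.exists_isClub_matchesAt hκ hκ' hψ
  obtain ⟨C₁, hC₁, hCb⟩ := hT.exists_isClub_vanishing_of_isRegressive hκ hκ' hreg
  have hseq : ∀ δ ∈ cofOmega κ, ∃ s : ℕ → OrdBelow κ,
      StrictMono s ∧ (∀ n, s n < δ) ∧ ∀ β < δ, ∃ n, β ≤ s n :=
    fun δ hδ => OrdBelow.exists_seq_of_mem_cofOmega hδ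
  choose! s hsmono hsδ hscof using hseq
  let C := C₀ ∩ C₁
  have hS : IsStationary (cofOmega κ ∩ C) :=
    (OrdBelow.isStationary_cofOmega hκ hκ').inter_isClub hα (hC₀.inter hα.ne' hC₁)
  have hvan : ∀ δ ∈ cofOmega κ ∩ C, ∃ b, IsVanishingBranch hT.toIsKappaTree δ b := fun δ hδ =>
    hCb δ hδ.2.2 (OrdBelow.isSuccLimit_of_mem_cofOmega hδ.1) (s δ) (hsδ δ hδ.1) (hscof δ hδ.1)
  choose! b hb using hvan
  have hm : ∀ δ ∈ cofOmega κ ∩ C, MatchesAt hT.toIsKappaTree ψ δ := fun δ hδ => hCψ δ hδ.2.1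
  obtain ⟨f, hf⟩ := hT.exists_coloring_of_code hκ hκ' hS hm hb
  let sc : OrdBelow κ → OrdBelow κ := fun β => ⟨succ β.1, OrdBelow.succ_lt hκ β⟩
  have hlimit : ∀ δ : cofOmega κ, IsSuccLimit δ.1.1 :=
    fun δ => OrdBelow.isSuccLimit_of_mem_cofOmega δ.2
  -- Off the club the ladder must still be defined. It consists of successors, hence is disjoint
  -- from the branch ladders, whose codes are limit ordinals.
  let A : OrdBelow κ → Set (OrdBelow κ) := fun δ =>
    if δ ∈ C then ψ '' b δ else range fun n => sc (s δ n)
  have hA : ∀ δ ∈ C, A δ = ψ '' b δ := fun δ hδ => if_pos hδ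
  have hA' : ∀ δ ∉ C, A δ = range fun n => sc (s δ n) := fun δ hδ => if_neg hδ
  let L : LadderSystem κ (cofOmega κ) :=
    { isStationary := OrdBelow.isStationary_cofOmega hκ hκ'
      ladder := fun δ => A δ
      lt_of_mem := fun δ α hα => by
        by_cases hδ : δ.1 ∈ C
        · rw [hA _ hδ] at hα
          exact (hb δ ⟨δ.2, hδ⟩).code_lt (hm δ ⟨δ.2, hδ⟩) α hα
        · rw [hA' _ hδ] at hα
          obtain ⟨n, rfl⟩ := hα
          exact (hlimit δ).succ_lt (hsδ δ δ.2 n)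
      cofinal := fun δ β hβ => by
        by_cases hδ : δ.1 ∈ C
        · rw [hA _ hδ]
          exact (hb δ ⟨δ.2, hδ⟩).exists_le_code (hm δ ⟨δ.2, hδ⟩) hβ
        · rw [hA' _ hδ]
          obtain ⟨n, hn⟩ := hscof δ δ.2 β hβ
          exact ⟨_, ⟨n, rfl⟩, hn.trans (le_succ (s δ n).1)⟩ }
  have hlim : ∀ δ : cofOmega κ, ∀ β < (δ : OrdBelow κ), ∃ γ, β < γ ∧ γ < (δ : OrdBelow κ) :=
    fun δ => exists_between_of_isSuccLimit (hlimit δ)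
  have hbot : ∀ δ : cofOmega κ, ∃ β, β < (δ : OrdBelow κ) :=
    fun δ => exists_lt_of_isSuccLimit (hlimit δ)
  have hmix : ∀ α, ∀ y : T, ψ y ≠ sc α := fun α y h =>
    not_isSuccLimit_succ α.1 (show IsSuccLimit (sc α).1 from h ▸ hψlim y)
  have hdisj : ∀ δ δ' : cofOmega κ, δ ≠ δ' → ∃ β < (δ' : OrdBelow κ),
      ∀ α ∈ L.ladder δ, α ∈ L.ladder δ' → α < β := by
    intro δ δ' hne
    rcases lt_or_gt_of_ne (Subtype.coe_ne_coe.2 hne) with h | h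
    · exact ⟨δ, h, fun α hα _ => L.lt_of_mem δ α hα⟩
    change ∃ β < (δ' : OrdBelow κ), ∀ α ∈ A δ, α ∈ A δ' → α < β
    by_cases hδ : δ.1 ∈ C
    · rw [hA _ hδ]
      by_cases hδ' : δ'.1 ∈ C
      · rw [hA _ hδ']
        exact (hb δ ⟨δ.2, hδ⟩).exists_bound hψ (hb δ' ⟨δ'.2, hδ'⟩) (hm δ' ⟨δ'.2, hδ'⟩) h
      · rw [hA' _ hδ']
        obtain ⟨β, hβ⟩ := hbot δ'
        refine ⟨β, hβ, ?_⟩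
        rintro _ ⟨y, -, rfl⟩ ⟨n, hn⟩
        exact (hmix _ y hn.symm).elim
    · rw [hA' _ hδ]
      obtain ⟨n, hn⟩ := hscof δ δ.2 δ' h
      -- From index `n` on, the sequence at `δ` is at or above `δ'`; only finitely many of its terms
      -- remain below `δ'`, and these are bounded there.
      have hne : ∃ β < (δ' : OrdBelow κ), ∀ m < n, sc (s δ m) < δ' → sc (s δ m) < β := by
        clear hn
        induction n with
        | zero =>
          obtain ⟨β, hβ⟩ := hbot δ'
          exact ⟨β, hβ, fun m hm => (Nat.not_lt_zero m hm).elim⟩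
        | succ n ih =>
          obtain ⟨β, hβ, h⟩ := ih
          by_cases hn : sc (s δ n) < δ'
          · obtain ⟨γ, hγ, hγδ⟩ := hlim δ' _ hn
            refine ⟨max β γ, max_lt hβ hγδ, fun m hm hmδ => ?_⟩
            rcases Nat.lt_succ_iff_lt_or_eq.1 hm with hm | rfl
            · exact (h m hm hmδ).trans_le (le_max_left _ _)
            · exact hγ.trans_le (le_max_right _ _)
          · refine ⟨β, hβ, fun m hm hmδ => ?_⟩
            rcases Nat.lt_succ_iff_lt_or_eq.1 hm with hm | rfl
            · exact h m hm hmδ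
            · exact (hn hmδ).elim
      obtain ⟨β, hβ, hβ'⟩ := hne
      refine ⟨β, hβ, ?_⟩
      rintro _ ⟨m, rfl⟩ hmem
      have hlt : sc (s δ m) < δ' := L.lt_of_mem δ' _ hmem
      refine hβ' m ?_ hlt
      by_contra! hnm
      have : (δ' : OrdBelow κ) ≤ s δ m := hn.trans ((hsmono δ δ.2).monotone hnm)
      exact (hlt.trans_le this).not_ge (le_succ (s δ m).1)
  refine ⟨L, LadderSystem.t2Space hlim hbot hdisj, LadderSystem.regularSpace hlim hbot hdisj,
    LadderSystem.not_countablyMetacompact hbot (fun δ => f δ) fun g => ?_,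
    LadderSystem.firstCountableTopology fun δ => ⟨s δ, hsδ δ δ.2, hscof δ δ.2⟩⟩
  obtain ⟨δ, hδ, h⟩ := hf g
  refine ⟨⟨δ, hδ.1⟩, ?_⟩
  change ∀ β < δ, ∃ α ∈ A δ, _
  rwa [hA _ hδ.2]

end SetTree

theorem theoremC (κ : Cardinal.{u}) (hκ : κ.IsRegular) (hκ_unc : ℵ₀ < κ)
    (T : Type u) [PartialOrder T] [IsSetTree T] (hT : SetTree.IsSouslin κ T) :
    (∃ (S : Set (OrdBelow κ)) (L : LadderSystem κ S),
      T2Space L.Space ∧ RegularSpace L.Space ∧ ¬ CountablyMetacompact L.Space) ∧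
    (SetTree.IsRegressive T →
      ∃ L : LadderSystem κ (cofOmega κ),
        T2Space L.Space ∧ RegularSpace L.Space ∧ ¬ CountablyMetacompact L.Space ∧
          FirstCountableTopology L.Space) ∧
    (SetTree.IsCoherent T → SetTree.IsRegressive T) :=
  ⟨hT.exists_ladderSystem hκ hκ_unc, hT.exists_ladderSystem_cofOmega hκ hκ_unc,
    SetTree.IsCoherent.isRegressive⟩
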